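/- Let $\mathbb D=\{z\in\mathbb C:|z|<1\}$, let $dA=\pi^{-1}\,dx\,dy$ be the normalized area measure on $\mathbb D$, and for $0<p<\infty$, $\alpha>-1$ put $$\|f\|_{p,\alpha}=\left(\int_{\mathbb D}|f(z)|^p(\alpha+1)(1-|z|^2)^\alpha\,dA(z)\right)^{1/p}.$$ Let $A^p_\alpha$ be the set of all functions $f$ analytic in $\mathbb D$ with $\|f\|_{p,\alpha}<\infty$. For $a\in\mathbb D$ let $\varphi_a(z)=\dfrac{a-z}{1-\overline a z}$. **Theorem.** Let $0<p<\infty$, $\alpha>-1$, let $N\ge 1$ be an integer and let $a\in\mathbb D$. If $f\in A^p_\alpha$ and $f(a)=f'(a)=\dots=f^{(N-1)}(a)=0$, then $f/\varphi_a^N$ (with its removable singularity at $a$ removed) belongs to $A^p_\alpha$ and $$\left\|\frac{f}{\varphi_a^N}\right\|_{p,\alpha}\le\left(\frac{\Gamma\left(\frac{Np}{2}+2+\alpha\right)}{\Gamma(2+\alpha)\,\Gamma\left(\frac{Np}{2}+1\right)}\right)^{1/p}\|f\|_{p,\alpha}.$$ The inequality is sharp: for each fixed $p,\alpha,N,a$,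 the constant cannot be replaced by a smaller one. Among the functions $f$ considered, equality holds if and only if $f$ is a constant multiple of $$\frac{(a-z)^N(1-|a|^2)^{\frac{2+\alpha}{p}}}{(1-\overline a z)^{N+\frac{2(2+\alpha)}{p}}}$$ (principal branch of the power), and this function itself belongs to $A^p_\alpha$ and has a zero of order at least $N$ at $a$. In particular, for $\alpha=0$ and $N=1$, the inequality becomes $$\left\|\frac{f}{\varphi_a}\right\|_{p,0}\le\left(\frac{p+2}{2}\right)^{1/p}\|f\|_{p,0}$$ for all $f\in A^p_0$ with $f(a)=0$, and this constant is the best possible. -/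

import Mathlib

open MeasureTheory
open scoped ENNReal ComplexConjugate

noncomputable section

/-- The open unit disk of the complex plane. -/
def unitDisk : Set ℂ := Metric.ball 0 1

/-- The normalized Lebesgue area measure `dA = π⁻¹ dx dy` on the unit disk. -/
def diskArea : Measure ℂ := ENNReal.ofReal Real.pi⁻¹ • volume.restrict unitDisk

/-- The standard radial weight `ω_α(z) = (α + 1) (1 - |z|²) ^ α`. -/
def stdWeight (α : ℝ) (z : ℂ) : ℝ := (α + 1) * (1 - ‖z‖ ^ 2) ^ α

/-- The (possibly infinite) quantity `‖f‖_{p,α} = (∫_𝔻 |f|^p ω_α dA)^{1/p}`. -/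
def bergmanNorm (p α : ℝ) (f : ℂ → ℂ) : ℝ≥0∞ :=
  (∫⁻ z, ‖f z‖ₑ ^ p * ENNReal.ofReal (stdWeight α z) ∂diskArea) ^ (1 / p)

/-- The weighted Bergman space `A^p_α`: functions analytic in the unit disk with
`‖f‖_{p,α} < ∞`. Values outside the disk play no role. -/
def bergmanSpace (p α : ℝ) : Set (ℂ → ℂ) :=
  {f | AnalyticOnNhd ℂ f unitDisk ∧ bergmanNorm p α f < ∞}

/-- The functions in `A^p_α` with a zero of order at least `N` at `a`. -/
def bergmanVanishing (p α : ℝ) (N : ℕ) (a : ℂ) : Set (ℂ → ℂ) :=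
  {f | f ∈ bergmanSpace p α ∧ ∀ k < N, iteratedDeriv k f a = 0}

/-- The disk automorphism `φ_a(z) = (a - z) / (1 - conj a * z)`. -/
def diskAut (a z : ℂ) : ℂ := (a - z) / (1 - conj a * z)

/-- The pointwise quotient `f / φ_a ^ N` (its value at the single point `a` is irrelevant
for `bergmanNorm`). -/
def divAut (a : ℂ) (N : ℕ) (f : ℂ → ℂ) (z : ℂ) : ℂ := f z / diskAut a z ^ N

/-- The function `(a - z)^N (1 - |a|²)^{(2+α)/p} / (1 - conj a * z)^{N + 2(2+α)/p}`;
the power in the denominator is the principal one, and `1 - conj a * z` has positive real part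
for `a`, `z` in the unit disk. -/
def extremalFun (p α : ℝ) (N : ℕ) (a z : ℂ) : ℂ :=
  (a - z) ^ N * (((1 - ‖a‖ ^ 2) ^ ((2 + α) / p) : ℝ) : ℂ) /
    (1 - conj a * z) ^ (((N : ℝ) + 2 * (2 + α) / p : ℝ) : ℂ)

end

/-! The measure `bergmanMeasure α` is a radial probability measure μ on the disk. Write f = φ_a^N g,
and let J = `autFactor p α a`, whose |J|^p is the density factor produced by z = φ_a(w). Since φ_a
is an involution, G = (g ∘ φ_a) J satisfies ‖f/φ_a^N‖^p = ∫ |G|^p dμ and ‖f‖^p = ∫ |w|^s |G|^p dμ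
with s = Np. The claim becomes m ∫ |G|^p dμ ≤ ∫ |w|^s |G|^p dμ with m = ∫ |w|^s dμ, a Beta integral
whose reciprocal is the constant inside the p-th root.

Because μ and |w|^s are radial, |G|^p may be replaced by its circular means `rotMean`. These
increase with the radius because |G|^p is subharmonic, and so does |w|^s, so Chebyshev's integral
inequality for two increasing functions applies (`bergmanMoment_mul_lintegral_le`).

Equality makes the circular means constant, and this forces G to be constant
(`eqOn_const_of_rotMean_eq`). By (J ∘ φ_a) J = 1, this means g = cJ, that is, f = c φ_a^N J, a
multiple of the extremal function. That function has finite nonzero norm, so the constant is sharp.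
-/

section

open Metric Set Filter Topology Real

/-! ### Subharmonicity of |g|^p -/

/-- The submean value inequality for `‖g‖ ^ p`. -/
theorem norm_rpow_le_circleAverage {p : ℝ} (hp : 0 < p) {g : ℂ → ℂ} {c : ℂ} {R : ℝ} (hR : 0 < R)
    (hg : AnalyticOnNhd ℂ g (closedBall c R)) :
    ‖g c‖ ^ p ≤ circleAverage (fun z => ‖g z‖ ^ p) c R := by
  have hR' : |R| = R := abs_of_pos hR
  by_cases h0 : g c = 0
  · rw [h0, norm_zero, zero_rpow hp.ne']
    exact circleAverage_nonneg_of_nonneg fun z _ => by positivity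
  have hg' : AnalyticOnNhd ℂ g (closedBall c |R|) := by rwa [hR']
  have hlog : CircleIntegrable (fun z => log ‖g z‖) c R :=
    (hg'.mono sphere_subset_closedBall).meromorphicOn.circleIntegrable_log_norm
  -- Jensen's formula: the zeros of g contribute only nonnegative terms.
  have hjensen : log ‖g c‖ ≤ circleAverage (fun z => log ‖g z‖) c R := by
    rw [hg'.circleAverage_log_norm hR.ne' h0]
    refine le_add_of_nonneg_left (finsum_nonneg fun u => ?_)
    by_cases hu : u ∈ closedBall c |R|
    · refine mul_nonneg ?_ ?_
      · exact_mod_cast (MeromorphicOn.AnalyticOnNhd.divisor_nonneg hg') u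
      · rcases eq_or_ne u c with rfl | huc
        · simp
        · have h1 : 0 < ‖c - u‖ := norm_pos_iff.2 (sub_ne_zero.2 huc.symm)
          refine log_nonneg ?_
          rw [← div_eq_mul_inv, le_div_iff₀ h1, one_mul, ← hR', ← dist_eq_norm, dist_comm]
          exact hu
    · simp [hu]
  set A : ℝ := ‖g c‖ ^ p
  have hA : 0 < A := rpow_pos_of_pos (norm_pos_iff.2 h0) p
  -- The bound e^x ≥ 1 + x at x = p (log |g z| - log |g c|) gives f₁ ≤ |g|^p off the zeros. At a
  -- zero the convention log 0 = 0 can break it, so f₂ takes the value 0 there; this changes f₁ only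
  -- on a discrete set.
  set f₁ : ℂ → ℝ := fun z => A * (1 - p * log ‖g c‖) + (A * p) * log ‖g z‖ with hf₁
  set f₂ : ℂ → ℝ := fun z => if g z = 0 then 0 else f₁ z with hf₂
  have hf₁i : CircleIntegrable f₁ c R :=
    (circleIntegrable_const _ c R).add (hlog.const_fun_smul (a := A * p))
  have hcod : f₁ =ᶠ[codiscreteWithin (sphere c |R|)] f₂ := by
    have h1 := hg'.preimage_zero_mem_codiscreteWithin h0 (mem_closedBall_self (abs_nonneg R))
      ((convex_closedBall c |R|).isConnected ⟨c, mem_closedBall_self (abs_nonneg R)⟩)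
    filter_upwards [codiscreteWithin_mono sphere_subset_closedBall h1] with z hz
    have : g z ≠ 0 := hz
    simp [hf₂, this]
  have hle : circleAverage f₂ c R ≤ circleAverage (fun z => ‖g z‖ ^ p) c R := by
    refine circleAverage_mono (hf₁i.congr_codiscreteWithin hcod) ?_ fun z _ => ?_
    · refine ContinuousOn.circleIntegrable hR.le ?_
      exact ((hg.mono sphere_subset_closedBall).continuousOn.norm.rpow_const
        fun _ _ => Or.inr hp.le)
    · by_cases hz : g z = 0
      · simp [hf₂, hz, zero_rpow hp.ne']
      · simp only [hf₂, hz, if_false, hf₁]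
        have hz' := norm_pos_iff.2 hz
        have h1 : ‖g z‖ ^ p = A * exp (p * (log ‖g z‖ - log ‖g c‖)) := by
          rw [← log_div hz'.ne' (norm_ne_zero_iff.2 h0), mul_comm p, exp_mul, exp_log
            (div_pos hz' (norm_pos_iff.2 h0)), div_rpow hz'.le (norm_nonneg _),
            mul_div_cancel₀ _ hA.ne']
        rw [h1]
        nlinarith [add_one_le_exp (p * (log ‖g z‖ - log ‖g c‖))]
  refine le_trans ?_ hle
  have h2 := circleAverage_fun_smul (a := A * p) (f := fun z => log ‖g z‖) (c := c) (R := R)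
  have h3 := circleAverage_fun_add (circleIntegrable_const (A * (1 - p * log ‖g c‖)) c R)
    (hlog.const_fun_smul (a := A * p))
  simp only [smul_eq_mul] at h2 h3
  rw [← circleAverage_congr_codiscreteWithin hcod hR.ne', hf₁, h3, circleAverage_const, h2]
  nlinarith [mul_le_mul_of_nonneg_left hjensen (mul_pos hA hp).le]

/-! ### Circular means: monotonicity and rigidity -/

/-- The mean of `‖g‖ ^ p` over the circle through `w` centred at the origin. -/
noncomputable def rotMean (p : ℝ) (g : ℂ → ℂ) (w : ℂ) : ℝ :=
  circleAverage (fun ζ => ‖g (w * ζ)‖ ^ p) 0 1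

theorem rotMean_nonneg (p : ℝ) (g : ℂ → ℂ) (w : ℂ) : 0 ≤ rotMean p g w :=
  circleAverage_nonneg_of_nonneg fun _ _ => by positivity

theorem rotMean_zero (p : ℝ) (g : ℂ → ℂ) : rotMean p g 0 = ‖g 0‖ ^ p := by
  simp [rotMean, circleAverage_const]

theorem rotMean_eq_of_norm_eq (p : ℝ) (g : ℂ → ℂ) {w w' : ℂ} (h : ‖w‖ = ‖w'‖) :
    rotMean p g w = rotMean p g w' := by
  rcases eq_or_ne w 0 with rfl | hw
  · rw [norm_zero, eq_comm, norm_eq_zero] at h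
    rw [h]
  have hw' : w' = w * Complex.exp (Complex.arg (w' / w) * Complex.I) := by
    have := Complex.norm_mul_exp_arg_mul_I (w' / w)
    rw [norm_div, h, div_self (by rw [← h]; exact norm_ne_zero_iff.2 hw)] at this
    rw [Complex.ofReal_one, one_mul] at this
    rw [this]
    field_simp
  rw [rotMean, rotMean, circleAverage_eq_integral_add (Complex.arg (w' / w)), circleAverage_def]
  congr 1
  refine intervalIntegral.integral_congr fun θ _ => ?_
  conv_rhs => rw [hw']
  simp only [circleMap, zero_add, Complex.ofReal_one, one_mul, Complex.ofReal_add, add_mul,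
    Complex.exp_add]
  ring_nf

theorem mul_circleMap_mem_ball {w : ℂ} {r : ℝ} (hw : w ∈ ball (0 : ℂ) r) (θ : ℝ) :
    w * circleMap 0 1 θ ∈ ball (0 : ℂ) r := by
  simpa using hw

theorem continuousOn_rotMean {p : ℝ} (hp : 0 < p) {g : ℂ → ℂ} {r : ℝ}
    (hg : ContinuousOn g (ball 0 r)) : ContinuousOn (rotMean p g) (ball 0 r) := by
  rw [continuousOn_iff_continuous_domRestrict]
  refine (intervalIntegral.continuous_parametric_intervalIntegral_of_continuous' (μ := volume)
    (f := fun (x : ball (0 : ℂ) r) θ => ‖g (x * circleMap 0 1 θ)‖ ^ p) ?_ 0 (2 * π)).const_smul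
      (2 * π)⁻¹
  have h1 : Continuous fun x : ball (0 : ℂ) r × ℝ => (x.1 : ℂ) * circleMap 0 1 x.2 := by fun_prop
  exact ((hg.comp_continuous h1 fun x => mul_circleMap_mem_ball x.1.2 x.2).norm).rpow_const
    fun _ => Or.inr hp.le

/-- Each z ↦ |g(zζ)|^p has the submean property, and averaging over ζ preserves it by Fubini. -/
theorem rotMean_le_circleAverage {p : ℝ} (hp : 0 < p) {g : ℂ → ℂ} {r : ℝ}
    (hg : AnalyticOnNhd ℂ g (ball 0 r)) {c : ℂ} {ρ : ℝ} (hρ : 0 < ρ)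
    (hc : closedBall c ρ ⊆ ball 0 r) :
    rotMean p g c ≤ circleAverage (rotMean p g) c ρ := by
  have hcont : Continuous fun x : ℝ × ℝ => ‖g (circleMap c ρ x.1 * circleMap 0 1 x.2)‖ ^ p := by
    have h1 : Continuous fun x : ℝ × ℝ => circleMap c ρ x.1 * circleMap 0 1 x.2 := by fun_prop
    exact ((hg.continuousOn.comp_continuous h1 fun x => mul_circleMap_mem_ball
      (hc (circleMap_mem_closedBall c hρ.le x.1)) x.2).norm).rpow_const fun _ => Or.inr hp.le
  have hswap : circleAverage (rotMean p g) c ρ =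
      circleAverage (fun ζ => circleAverage (fun z => ‖g (z * ζ)‖ ^ p) c ρ) 0 1 := by
    simp only [circleAverage_def, rotMean, smul_eq_mul, intervalIntegral.integral_const_mul]
    rw [intervalIntegral_intervalIntegral_swap]
    exact (hcont.continuousOn.integrableOn_compact (isCompact_uIcc.prod isCompact_uIcc)).mono_set
      (prod_mono uIoc_subset_uIcc uIoc_subset_uIcc)
  rw [hswap, rotMean]
  have hmem : ∀ ζ ∈ sphere (0 : ℂ) 1, ∀ z ∈ closedBall c ρ, z * ζ ∈ ball (0 : ℂ) r := by
    intro ζ hζ z hz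
    have := hc hz
    simp_all
  have hc0 : c ∈ closedBall c ρ := mem_closedBall_self hρ.le
  refine circleAverage_mono ?_ ?_ fun ζ hζ => ?_
  · refine ContinuousOn.circleIntegrable zero_le_one (ContinuousOn.rpow_const
      (ContinuousOn.norm ?_) fun _ _ => Or.inr hp.le)
    exact hg.continuousOn.comp (by fun_prop) fun ζ hζ => hmem ζ hζ c hc0
  · have hF (F : ℝ × ℝ → ℝ) (hF : Continuous F) :
        Continuous fun θ : ℝ => ∫ φ in 0..2 * π, F (φ, θ) :=
      intervalIntegral.continuous_parametric_intervalIntegral_of_continuous'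
        (f := fun θ φ : ℝ => F (φ, θ)) (by fun_prop) 0 (2 * π)
    have h1 := hF _ hcont
    exact (h1.const_smul (2 * π)⁻¹).intervalIntegrable _ _
  · rw [abs_one] at hζ
    refine norm_rpow_le_circleAverage (g := fun z => g (z * ζ)) hp hρ fun z hz => ?_
    have h1 : AnalyticAt ℂ (fun z : ℂ => z * ζ) z := by fun_prop
    exact AnalyticAt.comp (hg (z * ζ) (hmem ζ hζ z hz)) h1

/-- The circular means of `‖g‖ ^ p` increase with the radius. -/
theorem rotMean_mono {p : ℝ} (hp : 0 < p) {g : ℂ → ℂ} {r : ℝ}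
    (hg : AnalyticOnNhd ℂ g (ball 0 r)) {z w : ℂ} (hzw : ‖z‖ ≤ ‖w‖) (hw : w ∈ ball (0 : ℂ) r) :
    rotMean p g z ≤ rotMean p g w := by
  have hwr : ‖w‖ < r := by simpa using hw
  have hsub : closedBall (0 : ℂ) ‖w‖ ⊆ ball 0 r := closedBall_subset_ball hwr
  have hcont := continuousOn_rotMean hp hg.continuousOn
  obtain ⟨m, hm, hmax⟩ := (isCompact_closedBall (0 : ℂ) ‖w‖).exists_isMaxOn
    ⟨0, mem_closedBall_self (norm_nonneg w)⟩ (hcont.mono hsub)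
  have hz : z ∈ closedBall (0 : ℂ) ‖w‖ := by simpa using hzw
  refine (hmax hz).trans ?_
  have hm' : ‖m‖ ≤ ‖w‖ := by simpa using hm
  rcases hm'.eq_or_lt with hmw | hmw
  · exact (rotMean_eq_of_norm_eq p g hmw).le
  by_contra! hlt
  -- The circle about the maximum point m with this radius touches |z| = ‖w‖ from inside. At the
  -- contact point the mean is strictly below its maximum, contradicting the submean inequality at
  -- m.
  set ρ := ‖w‖ - ‖m‖ with hρ
  have hρ0 : 0 < ρ := sub_pos.2 hmw
  have hball : closedBall m ρ ⊆ closedBall 0 ‖w‖ := by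
    refine closedBall_subset_closedBall' ?_
    simp [hρ]
  have hsph : ∀ θ : ℝ, circleMap m ρ θ ∈ closedBall (0 : ℂ) ‖w‖ := fun θ =>
    hball (circleMap_mem_closedBall m hρ0.le θ)
  have hcm : Continuous fun θ : ℝ => rotMean p g (circleMap m ρ θ) :=
    hcont.comp_continuous (continuous_circleMap m ρ) fun θ => hsub (hsph θ)
  have h1 := rotMean_le_circleAverage hp hg hρ0 (hball.trans hsub)
  have h2 : ∫ θ in 0..2 * π, rotMean p g (circleMap m ρ θ) < ∫ _ in 0..2 * π, rotMean p g m := by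
    have hπ := two_pi_pos
    obtain ⟨θ, hθ, hval⟩ : ∃ θ ∈ Icc 0 (2 * π), ‖circleMap m ρ θ‖ = ‖w‖ := by
      have hnn : circleMap m ρ (Complex.arg m) =
          (‖w‖ : ℂ) * Complex.exp (Complex.arg m * Complex.I) := by
        rw [circleMap]
        conv_lhs => enter [1]; rw [← Complex.norm_mul_exp_arg_mul_I m]
        rw [hρ]; push_cast; ring
      have hn : ‖circleMap m ρ (Complex.arg m)‖ = ‖w‖ := by
        rw [hnn, norm_mul, Complex.norm_exp_ofReal_mul_I]; simp
      rcases le_or_gt 0 (Complex.arg m) with h | h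
      · exact ⟨_, ⟨h, (Complex.arg_le_pi m).trans (by linarith [pi_pos])⟩, hn⟩
      -- The contact point lies in the direction of m; a negative argument is shifted into [0, 2π].
      · refine ⟨Complex.arg m + 2 * π, ⟨?_, by linarith⟩, ?_⟩
        · linarith [Complex.neg_pi_lt_arg m, pi_pos]
        · rw [periodic_circleMap m ρ]; exact hn
    refine intervalIntegral.integral_lt_integral_of_continuousOn_of_le_of_exists_lt hπ
      hcm.continuousOn continuousOn_const (fun θ _ => hmax (hsph θ)) ⟨θ, hθ, ?_⟩
    rwa [rotMean_eq_of_norm_eq p g hval]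
  rw [circleAverage_def, smul_eq_mul] at h1
  rw [intervalIntegral.integral_const, smul_eq_mul, sub_zero] at h2
  have hπ := two_pi_pos
  rw [inv_mul_eq_div, le_div_iff₀ hπ] at h1
  linarith

/-- If the circular means of `‖g‖ ^ p` do not depend on the radius then `g` is constant. -/
theorem eqOn_const_of_rotMean_eq {p : ℝ} (hp : 0 < p) {g : ℂ → ℂ} {r : ℝ}
    (hr : 0 < r) (hg : AnalyticOnNhd ℂ g (ball 0 r))
    (h : ∀ w ∈ ball (0 : ℂ) r, rotMean p g w = ‖g 0‖ ^ p) :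
    ∀ w ∈ ball (0 : ℂ) r, g w = g 0 := by
  have h0r : (0 : ℂ) ∈ ball (0 : ℂ) r := mem_ball_self hr
  have hga := hg 0 h0r
  -- By the identity theorem and the maximum principle, it suffices that |g| is constant near 0.
  suffices hev : ∀ᶠ w in 𝓝 (0 : ℂ), g w = g 0 from
    hg.eqOn_of_preconnected_of_eventuallyEq analyticOnNhd_const
      (convex_ball (0 : ℂ) r).isPreconnected h0r hev
  refine Complex.eventually_eq_of_isLocalMax_norm
    (hga.eventually_analyticAt.mono fun z hz => hz.differentiableAt) ?_
  suffices hnorm : ∀ᶠ w in 𝓝 (0 : ℂ), ‖g w‖ = ‖g 0‖ from hnorm.mono fun w hw => hw.le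
  by_cases h0 : g 0 = 0
  · refine (isOpen_ball.eventually_mem h0r).mono fun w hw => ?_
    have h1 := h w hw
    rw [h0, norm_zero, zero_rpow hp.ne'] at h1
    obtain ⟨s, hs1, hs2⟩ := exists_between (mem_ball_zero_iff.1 hw)
    by_contra hne
    rw [h0, norm_zero, norm_eq_zero] at hne
    rw [rotMean, circleAverage_def, smul_eq_mul] at h1
    have hc : Continuous fun θ : ℝ => ‖g (w * circleMap 0 1 θ)‖ ^ p :=
      ((hg.continuousOn.comp_continuous (by fun_prop) fun θ =>
        mul_circleMap_mem_ball hw θ).norm).rpow_const fun _ => Or.inr hp.le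
    have : 0 < ∫ θ in 0..2 * π, ‖g (w * circleMap 0 1 θ)‖ ^ p := by
      refine intervalIntegral.integral_pos two_pi_pos hc.continuousOn
        (fun _ _ => by positivity) ⟨0, ⟨le_rfl, two_pi_pos.le⟩, ?_⟩
      simp only [circleMap, Complex.ofReal_zero, zero_mul, Complex.exp_zero, Complex.ofReal_one,
        zero_add, mul_one]
      have := norm_pos_iff.2 hne
      positivity
    have h2 := mul_pos (inv_pos.2 two_pi_pos) this
    exact h2.ne' h1
  -- A local branch with |k|² = |g/g(0)|^p. On small circles k has mean 1 by analyticity and |k|²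
  -- has mean 1 by hypothesis, so |k - 1|² has mean 1 - 2 + 1 = 0.
  set k : ℂ → ℂ := fun z => (g z / g 0) ^ ((p / 2 : ℝ) : ℂ) with hk
  have hslit : ∀ᶠ z in 𝓝 (0 : ℂ), g z / g 0 ∈ Complex.slitPlane := by
    have hc : ContinuousAt (fun z => g z / g 0) 0 := hga.continuousAt.div_const _
    refine hc.eventually_mem (Complex.isOpen_slitPlane.mem_nhds ?_)
    simp [div_self h0]
  obtain ⟨δ, hδ0, hδ⟩ := Metric.eventually_nhds_iff_ball.1
    (hslit.and (isOpen_ball.eventually_mem h0r))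
  have hkd : DifferentiableOn ℂ k (ball 0 δ) := fun z hz => by
    refine DifferentiableAt.differentiableWithinAt ?_
    exact ((hg z (hδ z hz).2).differentiableAt.div_const _).cpow_const (hδ z hz).1
  have hknorm : ∀ z, ‖k z‖ ^ 2 = ‖g z‖ ^ p / ‖g 0‖ ^ p ∨ z ∉ ball 0 δ := by
    intro z
    by_cases hz : z ∈ ball 0 δ
    · left
      have hne : g z / g 0 ≠ 0 := Complex.slitPlane_ne_zero (hδ z hz).1
      rw [hk]
      simp only
      rw [Complex.norm_cpow_of_ne_zero hne, Complex.ofReal_im, mul_zero, exp_zero, div_one,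
        Complex.ofReal_re, ← rpow_natCast, ← rpow_mul (norm_nonneg _), norm_div,
        div_rpow (norm_nonneg _) (norm_nonneg _)]
      norm_num
    · exact Or.inr hz
  have hk0 : k 0 = 1 := by simp [hk, div_self h0]
  filter_upwards [isOpen_ball.eventually_mem (mem_ball_self hδ0)] with w hw
  have hA : 0 < ‖g 0‖ ^ p := rpow_pos_of_pos (norm_pos_iff.2 h0) p
  have hwζ : ∀ ζ ∈ closedBall (0 : ℂ) 1, w * ζ ∈ ball (0 : ℂ) δ := by
    intro ζ hζ
    rw [mem_closedBall_zero_iff] at hζ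
    rw [mem_ball_zero_iff] at hw ⊢
    rw [norm_mul]
    nlinarith [norm_nonneg w]
  have hmean : circleAverage (fun ζ => k (w * ζ)) 0 1 = 1 := by
    have : DiffContOnCl ℂ (fun ζ => k (w * ζ)) (ball 0 |1|) := by
      rw [abs_one]
      refine DifferentiableOn.diffContOnCl ?_
      rw [closure_ball _ one_ne_zero]
      exact hkd.comp (by fun_prop) hwζ
    simpa [hk0] using this.circleAverage
  have hsq : circleAverage (fun ζ => ‖k (w * ζ)‖ ^ 2) 0 1 = 1 := by
    have h1 : circleAverage (fun ζ => ‖k (w * ζ)‖ ^ 2) 0 1 =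
        circleAverage (fun ζ => (‖g 0‖ ^ p)⁻¹ • ‖g (w * ζ)‖ ^ p) 0 1 := by
      refine circleAverage_congr_sphere fun ζ hζ => ?_
      rw [abs_one] at hζ
      have := (hknorm (w * ζ)).resolve_right fun h => h (hwζ ζ (sphere_subset_closedBall hζ))
      rw [this, smul_eq_mul, div_eq_inv_mul]
    rw [h1, circleAverage_fun_smul]
    have h2 := h w (hδ w hw).2
    rw [rotMean] at h2
    rw [h2, smul_eq_mul, inv_mul_cancel₀ hA.ne']
  clear_value k
  have hkc : Continuous fun θ : ℝ => k (w * circleMap 0 1 θ) :=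
    hkd.continuousOn.comp_continuous (by fun_prop) fun θ => mul_circleMap_mem_ball hw θ
  have hre : ∫ θ in 0..2 * π, (k (w * circleMap 0 1 θ)).re = 2 * π := by
    have h1 := Complex.reCLM.intervalIntegral_comp_comm
      (hkc.intervalIntegrable (μ := volume) 0 (2 * π))
    simp only [Complex.reCLM_apply] at h1
    rw [h1]
    rw [circleAverage_def, inv_smul_eq_iff₀ two_pi_pos.ne'] at hmean
    rw [hmean]
    simp
  have hsq' : ∫ θ in 0..2 * π, ‖k (w * circleMap 0 1 θ)‖ ^ 2 = 2 * π := by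
    rw [circleAverage_def, inv_smul_eq_iff₀ two_pi_pos.ne'] at hsq
    simpa using hsq
  have hzero : ∫ θ in 0..2 * π, ‖k (w * circleMap 0 1 θ) - 1‖ ^ 2 = 0 := by
    have h1 : ∀ θ : ℝ, ‖k (w * circleMap 0 1 θ) - 1‖ ^ 2 =
        ‖k (w * circleMap 0 1 θ)‖ ^ 2 - 2 * (k (w * circleMap 0 1 θ)).re + 1 := by
      intro θ
      rw [← Complex.normSq_eq_norm_sq, ← Complex.normSq_eq_norm_sq, Complex.normSq_sub]
      simp
      ring
    simp only [h1]
    rw [intervalIntegral.integral_add, intervalIntegral.integral_sub,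
      intervalIntegral.integral_const_mul, hre, hsq']
    · simp; ring
    · exact (hkc.norm.pow 2).intervalIntegrable _ _
    · exact ((Complex.continuous_re.comp hkc).const_mul 2).intervalIntegrable _ _
    · exact ((hkc.norm.pow 2).sub
        ((Complex.continuous_re.comp hkc).const_mul 2)).intervalIntegrable _ _
    · exact continuous_const.intervalIntegrable _ _
  have hkw1 : k w = 1 := by
    by_contra hne
    have : 0 < ∫ θ in 0..2 * π, ‖k (w * circleMap 0 1 θ) - 1‖ ^ 2 := by
      refine intervalIntegral.integral_pos two_pi_pos
        ((hkc.sub continuous_const).norm.pow 2).continuousOn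
        (fun _ _ => by positivity) ⟨0, ⟨le_rfl, two_pi_pos.le⟩, ?_⟩
      simp only [circleMap, Complex.ofReal_zero, zero_mul, Complex.exp_zero, Complex.ofReal_one,
        zero_add, mul_one]
      have := norm_pos_iff.2 (sub_ne_zero.2 hne)
      positivity
    exact this.ne' hzero
  have h3 := (hknorm w).resolve_right fun h => h hw
  rw [hkw1, norm_one, one_pow, eq_comm, div_eq_one_iff_eq hA.ne'] at h3
  exact rpow_left_injOn hp.ne' (norm_nonneg _) (norm_nonneg _) h3

/-! ### The measure ω_α dA: moments and rotation averages -/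

/-- The radial profile of the density of the measure `ω_α dA` with respect to Lebesgue measure. -/
noncomputable def radialDensity (α r : ℝ) : ℝ≥0∞ :=
  if r < 1 then ENNReal.ofReal (π⁻¹ * ((α + 1) * (1 - r ^ 2) ^ α)) else 0

/-- The measure `ω_α dA`. -/
noncomputable def bergmanMeasure (α : ℝ) : Measure ℂ :=
  volume.withDensity fun z => radialDensity α ‖z‖

theorem measurable_radialDensity (α : ℝ) : Measurable (radialDensity α) :=
  Measurable.ite measurableSet_Iio (by fun_prop) measurable_const

theorem measurable_radialDensity_norm (α : ℝ) : Measurable fun z : ℂ => radialDensity α ‖z‖ :=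
  (measurable_radialDensity α).comp measurable_norm

theorem lintegral_bergmanMeasure (α : ℝ) (f : ℂ → ℝ≥0∞) :
    ∫⁻ z, f z ∂bergmanMeasure α = ∫⁻ z, radialDensity α ‖z‖ * f z := by
  rw [bergmanMeasure, lintegral_withDensity_eq_lintegral_mul_non_measurable]
  · rfl
  · exact measurable_radialDensity_norm α
  · refine Eventually.of_forall fun z => ?_
    unfold radialDensity
    split_ifs <;> simp

theorem ae_bergmanMeasure_mem_ball (α : ℝ) : ∀ᵐ z ∂bergmanMeasure α, z ∈ ball (0 : ℂ) 1 := by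
  rw [bergmanMeasure, ae_withDensity_iff (measurable_radialDensity_norm α)]
  refine Eventually.of_forall fun z hz => ?_
  unfold radialDensity at hz
  by_contra h
  exact hz (if_neg (by simpa using h))

theorem bergmanMeasure_absolutelyContinuous (α : ℝ) : bergmanMeasure α ≪ volume :=
  withDensity_absolutelyContinuous _ _

/-- The density is strictly positive on the disk. Passing to Lebesgue measure lets almost everywhere
equalities of continuous functions become equalities everywhere. -/
theorem ae_restrict_ball_of_ae_bergmanMeasure {α : ℝ} (hα : -1 < α) {P : ℂ → Prop}
    (h : ∀ᵐ z ∂bergmanMeasure α, P z) : ∀ᵐ z ∂volume.restrict (ball (0 : ℂ) 1), P z := by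
  rw [bergmanMeasure, ae_withDensity_iff (measurable_radialDensity_norm α)] at h
  rw [ae_restrict_iff' measurableSet_ball]
  filter_upwards [h] with z hz hzb
  refine hz ?_
  have hz1 : ‖z‖ < 1 := by simpa using hzb
  have h2 : 0 < 1 - ‖z‖ ^ 2 := by nlinarith [norm_nonneg z]
  have h3 : 0 < α + 1 := by linarith
  rw [radialDensity, if_pos hz1]
  simp only [ne_eq, ENNReal.ofReal_eq_zero, not_le]
  positivity

theorem bergmanNorm_eq (p α : ℝ) (f : ℂ → ℂ) :
    bergmanNorm p α f = (∫⁻ z, ‖f z‖ₑ ^ p ∂bergmanMeasure α) ^ (1 / p) := by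
  rw [bergmanNorm, lintegral_bergmanMeasure, diskArea, lintegral_smul_measure, unitDisk,
    ← lintegral_indicator measurableSet_ball, smul_eq_mul,
    ← lintegral_const_mul' _ _ ENNReal.ofReal_ne_top]
  congr 2
  funext z
  by_cases hz : z ∈ ball (0 : ℂ) 1
  · have hz1 : ‖z‖ < 1 := by simpa using hz
    rw [indicator_of_mem hz, radialDensity, if_pos hz1, stdWeight,
      ENNReal.ofReal_mul (p := π⁻¹) (inv_nonneg.2 pi_pos.le)]
    ring
  · have hz1 : ¬ ‖z‖ < 1 := by simpa using hz
    rw [indicator_of_notMem hz, radialDensity, if_neg hz1]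
    simp

theorem lintegral_fun_norm (f : ℝ → ℝ≥0∞) (hf : Measurable f) :
    ∫⁻ z : ℂ, f ‖z‖ = ENNReal.ofReal (2 * π) * ∫⁻ r in Ioi (0 : ℝ), ENNReal.ofReal r * f r := by
  rw [← Complex.lintegral_comp_polarCoord_symm]
  simp only [Complex.norm_polarCoord_symm, smul_eq_mul, polarCoord_target]
  rw [Measure.volume_eq_prod, ← Measure.prod_restrict, lintegral_prod _ (by fun_prop)]
  simp only [lintegral_const, Measure.restrict_apply_univ, volume_Ioo]
  rw [mul_comm, ← lintegral_mul_const _ (by fun_prop)]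
  refine setLIntegral_congr_fun measurableSet_Ioi fun r hr => ?_
  rw [abs_of_pos hr]
  ring_nf

/-- The moments of `ω_α dA`. -/
noncomputable def bergmanMoment (α s : ℝ) : ℝ :=
  Gamma (s / 2 + 1) * Gamma (2 + α) / Gamma (s / 2 + 2 + α)

theorem bergmanMoment_pos {α s : ℝ} (hα : -1 < α) (hs : 0 ≤ s) : 0 < bergmanMoment α s :=
  div_pos (mul_pos (Gamma_pos_of_pos (by linarith)) (Gamma_pos_of_pos (by linarith)))
    (Gamma_pos_of_pos (by linarith))

/-- Polar coordinates and t = r² reduce the moment to the Beta integral B(s/2 + 1, α + 1), whose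
value is read off from the total mass one of the Beta distribution. -/
theorem lintegral_norm_rpow {α s : ℝ} (hα : -1 < α) (hs : 0 ≤ s) :
    ∫⁻ z, ENNReal.ofReal (‖z‖ ^ s) ∂bergmanMeasure α = ENNReal.ofReal (bergmanMoment α s) := by
  have hu : 0 < s / 2 + 1 := by linarith
  have hv : 0 < α + 1 := by linarith
  have hβ := ProbabilityTheory.beta_pos hu hv
  have hmom : bergmanMoment α s = (α + 1) * ProbabilityTheory.beta (s / 2 + 1) (α + 1) := by
    rw [bergmanMoment, ProbabilityTheory.beta, show 2 + α = (α + 1) + 1 by ring,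
      Gamma_add_one hv.ne', show s / 2 + 2 + α = s / 2 + 1 + (α + 1) by ring]
    ring
  have hB := ProbabilityTheory.lintegral_betaPDF_eq_one hu hv
  have himg : (fun r : ℝ => r ^ 2) '' Ioo 0 1 = Ioo 0 1 := by
    ext t
    constructor
    · rintro ⟨r, ⟨h0, h1⟩, rfl⟩
      exact ⟨by positivity, by nlinarith⟩
    · rintro ⟨h0, h1⟩
      exact ⟨√t, ⟨sqrt_pos.2 h0, by rw [sqrt_lt' one_pos]; simpa using h1⟩, sq_sqrt h0.le⟩
  rw [ProbabilityTheory.lintegral_betaPDF, ← himg, lintegral_image_eq_lintegral_abs_deriv_mul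
    (f' := fun r => 2 * r) measurableSet_Ioo
    (fun r _ => by simpa using (hasDerivAt_pow 2 r).hasDerivWithinAt)
    (fun x hx y hy hxy => (pow_left_inj₀ hx.1.le hy.1.le two_ne_zero).1 hxy)] at hB
  rw [lintegral_bergmanMeasure, lintegral_fun_norm (fun r => radialDensity α r *
    ENNReal.ofReal (r ^ s)) (by have := measurable_radialDensity α; fun_prop), hmom]
  have hind : (fun r => ENNReal.ofReal r * (radialDensity α r * ENNReal.ofReal (r ^ s))) =
      (Iio 1).indicator fun r =>
        ENNReal.ofReal r * (radialDensity α r * ENNReal.ofReal (r ^ s)) := by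
    funext r
    by_cases hr : r < 1
    · rw [indicator_of_mem (by exact hr)]
    · rw [indicator_of_notMem (by exact hr), radialDensity, if_neg hr, zero_mul, mul_zero]
  rw [hind, setLIntegral_indicator measurableSet_Iio, Iio_inter_Ioi]
  rw [← mul_one (ENNReal.ofReal ((α + 1) * _)), ← hB,
    ← lintegral_const_mul' _ _ ENNReal.ofReal_ne_top,
    ← lintegral_const_mul' _ _ ENNReal.ofReal_ne_top]
  generalize ProbabilityTheory.beta (s / 2 + 1) (α + 1) = B at hβ ⊢
  refine setLIntegral_congr_fun measurableSet_Ioo fun r hr => ?_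
  obtain ⟨hr0, hr1⟩ := hr
  have h1 : 0 < 1 - r ^ 2 := by nlinarith
  simp only [radialDensity, if_pos hr1]
  rw [abs_of_pos (by positivity : (0 : ℝ) < 2 * r)]
  rw [← ENNReal.ofReal_mul (by positivity), ← ENNReal.ofReal_mul (by positivity),
    ← ENNReal.ofReal_mul (by positivity), ← ENNReal.ofReal_mul (by positivity),
    ← ENNReal.ofReal_mul (by positivity)]
  congr 1
  have h2 : (r ^ 2) ^ (s / 2 + 1 - 1) = r ^ s := by
    rw [← rpow_natCast, ← rpow_mul hr0.le]
    congr 1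
    push_cast
    ring
  rw [h2, add_sub_cancel_right]
  field_simp

/-- Averaging over rotations does not change integrals against radial weights. -/
theorem lintegral_fun_norm_mul_eq_lintegral_rotation (φ : ℝ → ℝ≥0∞) (hφ : Measurable φ)
    (G : ℂ → ℝ≥0∞) (hG : Measurable G) :
    ∫⁻ z : ℂ, φ ‖z‖ * G z = ∫⁻ z : ℂ, φ ‖z‖ *
      (ENNReal.ofReal (2 * π)⁻¹ * ∫⁻ θ in Ioc 0 (2 * π), G (z * circleMap 0 1 θ)) := by
  -- Lebesgue measure and the weight are rotation invariant; averaging this identity over θ and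
  -- applying Tonelli gives the claim.
  have hrot (θ : ℝ) : ∫⁻ z : ℂ, φ ‖z‖ * G (z * circleMap 0 1 θ) = ∫⁻ z : ℂ, φ ‖z‖ * G z := by
    have hmp := (rotation (Circle.exp θ)).measurePreserving
    rw [← hmp.lintegral_comp (f := fun z => φ ‖z‖ * G z) (by fun_prop)]
    refine lintegral_congr fun z => ?_
    rw [LinearIsometryEquiv.norm_map, rotation_apply, Circle.coe_exp, mul_comm z]
    simp [circleMap]
  have h1 (z : ℂ) : φ ‖z‖ *
      (ENNReal.ofReal (2 * π)⁻¹ * ∫⁻ θ in Ioc 0 (2 * π), G (z * circleMap 0 1 θ)) =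
      ENNReal.ofReal (2 * π)⁻¹ * ∫⁻ θ in Ioc 0 (2 * π), φ ‖z‖ * G (z * circleMap 0 1 θ) := by
    have hz : Measurable fun θ : ℝ => G (z * circleMap 0 1 θ) := hG.comp (by fun_prop)
    rw [lintegral_const_mul _ hz]
    ring
  simp only [h1]
  rw [lintegral_const_mul' _ _ ENNReal.ofReal_ne_top, lintegral_lintegral_swap
    (Measurable.aemeasurable (by unfold Function.uncurry; fun_prop))]
  simp only [hrot]
  rw [lintegral_const, Measure.restrict_apply_univ, volume_Ioc, mul_comm (∫⁻ _, _), ← mul_assoc,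
    ← ENNReal.ofReal_mul (by positivity), sub_zero, inv_mul_cancel₀ two_pi_pos.ne',
    ENNReal.ofReal_one, one_mul]

theorem lintegral_fun_norm_mul_eq_lintegral_rotMean {p : ℝ} (hp : 0 < p) (α : ℝ) {g : ℂ → ℂ}
    (hg : ContinuousOn g (ball 0 1)) (φ : ℝ → ℝ≥0∞) (hφ : Measurable φ) :
    ∫⁻ z, φ ‖z‖ * ‖g z‖ₑ ^ p ∂bergmanMeasure α =
      ∫⁻ z, φ ‖z‖ * ENNReal.ofReal (rotMean p g z) ∂bergmanMeasure α := by
  classical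
  -- Nothing is known about g off the disk; cutting it off there gives a measurable function on the
  -- plane.
  set G : ℂ → ℝ≥0∞ := (ball (0 : ℂ) 1).indicator fun z => ‖g z‖ₑ ^ p with hGdef
  have hG : Measurable G := by
    rw [hGdef, ← piecewise_eq_indicator]
    exact ContinuousOn.measurable_piecewise
      (ENNReal.continuous_rpow_const.comp_continuousOn hg.enorm) continuousOn_const
      measurableSet_ball
  have h1 : ∫⁻ z, φ ‖z‖ * ‖g z‖ₑ ^ p ∂bergmanMeasure α =
      ∫⁻ z, (radialDensity α ‖z‖ * φ ‖z‖) * G z := by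
    rw [lintegral_congr_ae (g := fun z => φ ‖z‖ * G z), lintegral_bergmanMeasure]
    · simp only [mul_assoc]
    · filter_upwards [ae_bergmanMeasure_mem_ball α] with z hz
      rw [hGdef, indicator_of_mem hz]
  rw [h1, lintegral_fun_norm_mul_eq_lintegral_rotation (fun r => radialDensity α r * φ r)
    ((measurable_radialDensity α).mul hφ) G hG]
  simp only [mul_assoc (radialDensity _ _)]
  rw [← lintegral_bergmanMeasure]
  refine lintegral_congr_ae ?_
  filter_upwards [ae_bergmanMeasure_mem_ball α] with z hz
  congr 1
  have hc : Continuous fun θ : ℝ => ‖g (z * circleMap 0 1 θ)‖ ^ p :=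
    ((hg.comp_continuous (by fun_prop) fun θ => mul_circleMap_mem_ball hz θ).norm).rpow_const
      fun _ => Or.inr hp.le
  rw [rotMean, circleAverage_def, smul_eq_mul, ENNReal.ofReal_mul (by positivity),
    intervalIntegral.integral_of_le two_pi_pos.le, ofReal_integral_eq_lintegral_ofReal
      (hc.integrableOn_Ioc) (Eventually.of_forall fun _ => by positivity)]
  congr 1
  refine lintegral_congr fun θ => ?_
  rw [hGdef, indicator_of_mem (mul_circleMap_mem_ball hz θ),
    ← ENNReal.ofReal_rpow_of_nonneg (norm_nonneg _) hp.le, ofReal_norm]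

theorem bergmanMoment_zero {α : ℝ} (hα : -1 < α) : bergmanMoment α 0 = 1 := by
  have : Gamma (2 + α) ≠ 0 := (Gamma_pos_of_pos (by linarith)).ne'
  simp [bergmanMoment, this]

theorem lintegral_one_bergmanMeasure {α : ℝ} (hα : -1 < α) :
    ∫⁻ _, 1 ∂bergmanMeasure α = 1 := by
  simpa [bergmanMoment_zero hα] using lintegral_norm_rpow hα le_rfl

/-- A probability average of |z|^s ≤ 1 can reach 1 only if |z|^s = 1 almost everywhere, hence by
continuity at 0 too, which is absurd. -/
theorem bergmanMoment_lt_one {α s : ℝ} (hα : -1 < α) (hs : 0 < s) : bergmanMoment α s < 1 := by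
  by_contra! hle
  have hX := lintegral_norm_rpow hα hs.le
  have hX1 : (fun z : ℂ => ENNReal.ofReal (‖z‖ ^ s)) ≤ᵐ[bergmanMeasure α] fun _ => 1 := by
    filter_upwards [ae_bergmanMeasure_mem_ball α] with z hz
    rw [ENNReal.ofReal_le_one]
    exact rpow_le_one (norm_nonneg z) (mem_ball_zero_iff.1 hz).le hs.le
  have h1 := ae_eq_of_ae_le_of_lintegral_le hX1 (by rw [hX]; exact ENNReal.ofReal_ne_top)
    aemeasurable_const (by
      rw [hX, lintegral_one_bergmanMeasure hα]
      simpa using ENNReal.ofReal_le_ofReal hle)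
  have h2 : (fun z : ℂ => ‖z‖ ^ s) =ᵐ[volume.restrict (ball (0 : ℂ) 1)] fun _ => (1 : ℝ) := by
    filter_upwards [ae_restrict_ball_of_ae_bergmanMeasure hα h1] with z hz
    exact ENNReal.ofReal_eq_one.1 hz
  have h3 := Measure.eqOn_open_of_ae_eq h2 isOpen_ball
    (continuous_norm.rpow_const fun _ => Or.inr hs.le).continuousOn continuousOn_const
    (mem_ball_self one_pos)
  simp [zero_rpow hs.ne'] at h3

theorem aemeasurable_bergmanMeasure {α : ℝ} {f : ℂ → ℝ} (hf : ContinuousOn f (ball 0 1)) :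
    AEMeasurable f (bergmanMeasure α) := by
  refine (hf.aemeasurable measurableSet_ball).mono_ac (μ := bergmanMeasure α)
    (ν := volume.restrict (ball 0 1)) ?_
  have h := (bergmanMeasure_absolutelyContinuous α).restrict (ball (0 : ℂ) 1)
  rwa [Measure.restrict_eq_self_of_ae_mem (ae_bergmanMeasure_mem_ball α)] at h

/-! ### Chebyshev's inequality for radial means -/

section Chebyshev

variable {p α s : ℝ} {g : ℂ → ℂ}

/-- The point on the circle of radius `r` with `r ^ s = bergmanMoment α s`. -/
noncomputable def momentPoint (α s : ℝ) : ℂ := ((bergmanMoment α s ^ s⁻¹ : ℝ) : ℂ)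

theorem norm_momentPoint (hα : -1 < α) (hs : 0 < s) :
    ‖momentPoint α s‖ = bergmanMoment α s ^ s⁻¹ := by
  rw [momentPoint, Complex.norm_real, norm_of_nonneg]
  exact rpow_nonneg (bergmanMoment_pos hα hs.le).le _

theorem norm_momentPoint_rpow (hα : -1 < α) (hs : 0 < s) :
    ‖momentPoint α s‖ ^ s = bergmanMoment α s := by
  rw [norm_momentPoint hα hs, rpow_inv_rpow (bergmanMoment_pos hα hs.le).le hs.ne']

theorem momentPoint_mem_ball (hα : -1 < α) (hs : 0 < s) : momentPoint α s ∈ ball (0 : ℂ) 1 := by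
  rw [mem_ball_zero_iff, norm_momentPoint hα hs]
  exact rpow_lt_one (bergmanMoment_pos hα hs.le).le (bergmanMoment_lt_one hα hs) (inv_pos.2 hs)

/-- Both factors are nondecreasing in |z| and vanish at the radius of `momentPoint α s`, so they
never have opposite signs. -/
theorem mul_rotMean_sub_nonneg (hp : 0 < p) (hα : -1 < α) (hs : 0 < s)
    (hg : AnalyticOnNhd ℂ g (ball 0 1)) {z : ℂ} (hz : z ∈ ball (0 : ℂ) 1) :
    0 ≤ (‖z‖ ^ s - bergmanMoment α s) * (rotMean p g z - rotMean p g (momentPoint α s)) := by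
  rw [← norm_momentPoint_rpow hα hs]
  rcases le_total ‖z‖ ‖momentPoint α s‖ with h | h
  · refine mul_nonneg_of_nonpos_of_nonpos ?_ ?_
    · exact sub_nonpos.2 (rpow_le_rpow (norm_nonneg _) h hs.le)
    · exact sub_nonpos.2 (rotMean_mono hp hg h (momentPoint_mem_ball hα hs))
  · refine mul_nonneg ?_ ?_
    · exact sub_nonneg.2 (rpow_le_rpow (norm_nonneg _) h hs.le)
    · exact sub_nonneg.2 (rotMean_mono hp hg h hz)

/-- The pointwise inequality behind Chebyshev's integral inequality. -/
theorem chebyshev_ae_le (hp : 0 < p) (hα : -1 < α) (hs : 0 < s)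
    (hg : AnalyticOnNhd ℂ g (ball 0 1)) :
    (fun z => ENNReal.ofReal (bergmanMoment α s) * ENNReal.ofReal (rotMean p g z) +
        ENNReal.ofReal (‖z‖ ^ s) * ENNReal.ofReal (rotMean p g (momentPoint α s)))
      ≤ᵐ[bergmanMeasure α] fun z =>
        ENNReal.ofReal (‖z‖ ^ s) * ENNReal.ofReal (rotMean p g z) +
          ENNReal.ofReal (bergmanMoment α s) *
            ENNReal.ofReal (rotMean p g (momentPoint α s)) := by
  filter_upwards [ae_bergmanMeasure_mem_ball α] with z hz
  have hm := (bergmanMoment_pos hα hs.le).le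
  have h1 := rotMean_nonneg p g z
  have h2 := rotMean_nonneg p g (momentPoint α s)
  have h3 : 0 ≤ ‖z‖ ^ s := by positivity
  rw [← ENNReal.ofReal_mul hm, ← ENNReal.ofReal_mul h3, ← ENNReal.ofReal_mul h3,
    ← ENNReal.ofReal_mul hm, ← ENNReal.ofReal_add (by positivity) (by positivity),
    ← ENNReal.ofReal_add (by positivity) (by positivity)]
  refine ENNReal.ofReal_le_ofReal ?_
  nlinarith [mul_rotMean_sub_nonneg hp hα hs hg hz]

/-- Integrating |z|^s reproduces the moment, so this side acquires the same finite constant term as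
the other one, and the two cancel. -/
theorem lintegral_chebyshev_left (hα : -1 < α) (hs : 0 < s) (C : ℝ) (N : ℂ → ℝ≥0∞) :
    ∫⁻ z, (ENNReal.ofReal (bergmanMoment α s) * N z +
        ENNReal.ofReal (‖z‖ ^ s) * ENNReal.ofReal C) ∂bergmanMeasure α =
      ENNReal.ofReal (bergmanMoment α s) * ∫⁻ z, N z ∂bergmanMeasure α +
        ENNReal.ofReal (bergmanMoment α s) * ENNReal.ofReal C := by
  rw [lintegral_add_right _ (by fun_prop), lintegral_const_mul' _ _ ENNReal.ofReal_ne_top,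
    lintegral_mul_const' _ _ ENNReal.ofReal_ne_top, lintegral_norm_rpow hα hs.le]

theorem lintegral_chebyshev_right (hα : -1 < α) (C : ℝ≥0∞) (F : ℂ → ℝ≥0∞) :
    ∫⁻ z, (F z + C) ∂bergmanMeasure α = ∫⁻ z, F z ∂bergmanMeasure α + C := by
  rw [lintegral_add_right _ measurable_const, ← mul_one C, lintegral_const_mul _ measurable_const,
    lintegral_one_bergmanMeasure hα, mul_one]

theorem lintegral_enorm_rpow_eq (hp : 0 < p) (hg : AnalyticOnNhd ℂ g (ball 0 1)) :
    ∫⁻ z, ‖g z‖ₑ ^ p ∂bergmanMeasure α =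
      ∫⁻ z, ENNReal.ofReal (rotMean p g z) ∂bergmanMeasure α := by
  simpa using lintegral_fun_norm_mul_eq_lintegral_rotMean hp α hg.continuousOn (fun _ => 1)
    measurable_const

theorem lintegral_norm_rpow_mul_enorm_rpow_eq (hp : 0 < p) (hg : AnalyticOnNhd ℂ g (ball 0 1)) :
    ∫⁻ z, ENNReal.ofReal (‖z‖ ^ s) * ‖g z‖ₑ ^ p ∂bergmanMeasure α =
      ∫⁻ z, ENNReal.ofReal (‖z‖ ^ s) * ENNReal.ofReal (rotMean p g z) ∂bergmanMeasure α :=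
  lintegral_fun_norm_mul_eq_lintegral_rotMean hp α hg.continuousOn
    (fun r => ENNReal.ofReal (r ^ s)) (by fun_prop)

/-- Only a finite constant is cancelled, so the integrals may be infinite. Hence finiteness of the
right side yields finiteness of the integral on the left. -/
theorem bergmanMoment_mul_lintegral_le (hp : 0 < p) (hα : -1 < α) (hs : 0 < s)
    (hg : AnalyticOnNhd ℂ g (ball 0 1)) :
    ENNReal.ofReal (bergmanMoment α s) * ∫⁻ z, ‖g z‖ₑ ^ p ∂bergmanMeasure α ≤
      ∫⁻ z, ENNReal.ofReal (‖z‖ ^ s) * ‖g z‖ₑ ^ p ∂bergmanMeasure α := by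
  rw [lintegral_enorm_rpow_eq hp hg, lintegral_norm_rpow_mul_enorm_rpow_eq hp hg]
  have h := lintegral_mono_ae (chebyshev_ae_le hp hα hs hg)
  rw [lintegral_chebyshev_left hα hs, lintegral_chebyshev_right hα] at h
  exact (ENNReal.add_le_add_iff_right
    (ENNReal.mul_ne_top ENNReal.ofReal_ne_top ENNReal.ofReal_ne_top)).1 h

theorem eq_const_of_bergmanMoment_mul_lintegral_eq (hp : 0 < p) (hα : -1 < α) (hs : 0 < s)
    (hg : AnalyticOnNhd ℂ g (ball 0 1)) (hfin : ∫⁻ z, ‖g z‖ₑ ^ p ∂bergmanMeasure α ≠ ∞)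
    (heq : ENNReal.ofReal (bergmanMoment α s) * ∫⁻ z, ‖g z‖ₑ ^ p ∂bergmanMeasure α =
      ∫⁻ z, ENNReal.ofReal (‖z‖ ^ s) * ‖g z‖ₑ ^ p ∂bergmanMeasure α) :
    ∀ w ∈ ball (0 : ℂ) 1, g w = g 0 := by
  rw [lintegral_enorm_rpow_eq hp hg] at hfin
  rw [lintegral_enorm_rpow_eq hp hg, lintegral_norm_rpow_mul_enorm_rpow_eq hp hg] at heq
  have hN := continuousOn_rotMean hp hg.continuousOn
  have hNm : AEMeasurable (rotMean p g) (bergmanMeasure α) := aemeasurable_bergmanMeasure hN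
  -- Equal finite integrals turn the pointwise inequality into an almost everywhere equality, so the
  -- Chebyshev product vanishes, everywhere by continuity.
  have hae := ae_eq_of_ae_le_of_lintegral_le (chebyshev_ae_le hp hα hs hg)
    (by
      rw [lintegral_chebyshev_left hα hs]
      exact ENNReal.add_ne_top.2 ⟨ENNReal.mul_ne_top ENNReal.ofReal_ne_top hfin,
        ENNReal.mul_ne_top ENNReal.ofReal_ne_top ENNReal.ofReal_ne_top⟩)
    (by fun_prop)
    (by rw [lintegral_chebyshev_left hα hs, lintegral_chebyshev_right hα, heq])
  have hae' : (fun z : ℂ => (‖z‖ ^ s - bergmanMoment α s) *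
      (rotMean p g z - rotMean p g (momentPoint α s)))
      =ᵐ[volume.restrict (ball (0 : ℂ) 1)] fun _ => (0 : ℝ) := by
    filter_upwards [ae_restrict_ball_of_ae_bergmanMeasure hα hae] with z hz
    have hm := (bergmanMoment_pos hα hs.le).le
    have h1 := rotMean_nonneg p g z
    have h2 := rotMean_nonneg p g (momentPoint α s)
    have h3 : 0 ≤ ‖z‖ ^ s := by positivity
    rw [← ENNReal.ofReal_mul hm, ← ENNReal.ofReal_mul h3, ← ENNReal.ofReal_mul h3,
      ← ENNReal.ofReal_mul hm, ← ENNReal.ofReal_add (by positivity) (by positivity),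
      ← ENNReal.ofReal_add (by positivity) (by positivity),
      ENNReal.ofReal_eq_ofReal_iff (by positivity) (by positivity)] at hz
    linarith
  have hzero := Measure.eqOn_open_of_ae_eq hae' isOpen_ball
    (((continuous_norm.rpow_const fun _ => Or.inr hs.le).continuousOn.sub continuousOn_const).mul
      (hN.sub continuousOn_const)) continuousOn_const
  have hconst : ∀ w ∈ ball (0 : ℂ) 1, rotMean p g w = rotMean p g (momentPoint α s) := by
    intro w hw
    -- The first factor vanishes only on the circle through `momentPoint α s`, where the mean has
    -- the desired value anyway.
    rcases mul_eq_zero.1 (hzero hw) with h | h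
    · rw [← norm_momentPoint_rpow hα hs, sub_eq_zero] at h
      exact rotMean_eq_of_norm_eq p g
        (rpow_left_injOn hs.ne' (norm_nonneg _) (norm_nonneg _) h)
    · exact sub_eq_zero.1 h
  refine eqOn_const_of_rotMean_eq hp one_pos hg fun w hw => ?_
  rw [hconst w hw, ← hconst 0 (mem_ball_self one_pos), rotMean_zero]

end Chebyshev

/-! ### Disk automorphisms and change of variables -/

theorem norm_sq_eq_mul_conj (a : ℂ) : ((‖a‖ ^ 2 : ℝ) : ℂ) = conj a * a := by
  rw [mul_comm, Complex.mul_conj, Complex.normSq_eq_norm_sq]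

theorem re_one_sub_conj_mul_pos {a z : ℂ} (ha : a ∈ ball (0 : ℂ) 1) (hz : z ∈ ball (0 : ℂ) 1) :
    0 < (1 - conj a * z).re := by
  rw [mem_ball_zero_iff] at ha hz
  have h1 : (conj a * z).re ≤ ‖a‖ * ‖z‖ := by
    simpa using Complex.re_le_norm (conj a * z)
  rw [Complex.sub_re, Complex.one_re]
  nlinarith [norm_nonneg a, norm_nonneg z]

theorem one_sub_conj_mul_ne_zero {a z : ℂ} (ha : a ∈ ball (0 : ℂ) 1) (hz : z ∈ ball (0 : ℂ) 1) :
    1 - conj a * z ≠ 0 := by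
  intro h
  have := re_one_sub_conj_mul_pos ha hz
  simp [h] at this

theorem one_sub_norm_sq_pos {a : ℂ} (ha : a ∈ ball (0 : ℂ) 1) : 0 < 1 - ‖a‖ ^ 2 := by
  rw [mem_ball_zero_iff] at ha
  nlinarith [norm_nonneg a]

theorem one_sub_norm_diskAut_sq {a z : ℂ} (ha : a ∈ ball (0 : ℂ) 1) (hz : z ∈ ball (0 : ℂ) 1) :
    1 - ‖diskAut a z‖ ^ 2 = (1 - ‖a‖ ^ 2) * (1 - ‖z‖ ^ 2) / ‖1 - conj a * z‖ ^ 2 := by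
  have h := norm_pos_iff.2 (one_sub_conj_mul_ne_zero ha hz)
  rw [diskAut, norm_div, div_pow, eq_div_iff (by positivity), sub_mul,
    div_mul_cancel₀ _ (by positivity)]
  simp only [← Complex.normSq_eq_norm_sq, Complex.normSq_apply, Complex.sub_re, Complex.sub_im,
    Complex.mul_re, Complex.mul_im, Complex.conj_re, Complex.conj_im, Complex.one_re,
    Complex.one_im]
  ring

theorem diskAut_mem_ball {a z : ℂ} (ha : a ∈ ball (0 : ℂ) 1) (hz : z ∈ ball (0 : ℂ) 1) :
    diskAut a z ∈ ball (0 : ℂ) 1 := by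
  have h := norm_pos_iff.2 (one_sub_conj_mul_ne_zero ha hz)
  have h1 : 0 < 1 - ‖diskAut a z‖ ^ 2 := by
    rw [one_sub_norm_diskAut_sq ha hz]
    have := one_sub_norm_sq_pos ha
    have := one_sub_norm_sq_pos hz
    positivity
  rw [mem_ball_zero_iff]
  nlinarith [norm_nonneg (diskAut a z)]

theorem one_sub_conj_mul_diskAut {a z : ℂ} (ha : a ∈ ball (0 : ℂ) 1) (hz : z ∈ ball (0 : ℂ) 1) :
    1 - conj a * diskAut a z = ((1 - ‖a‖ ^ 2 : ℝ) : ℂ) * (1 - conj a * z)⁻¹ := by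
  have h := one_sub_conj_mul_ne_zero ha hz
  rw [Complex.ofReal_sub, norm_sq_eq_mul_conj, diskAut, ← div_eq_mul_inv, eq_div_iff h, sub_mul,
    mul_assoc (conj a), div_mul_cancel₀ _ h]
  push_cast
  ring

theorem diskAut_diskAut {a z : ℂ} (ha : a ∈ ball (0 : ℂ) 1) (hz : z ∈ ball (0 : ℂ) 1) :
    diskAut a (diskAut a z) = z := by
  have h := one_sub_conj_mul_ne_zero ha hz
  have h1 := one_sub_conj_mul_ne_zero ha (diskAut_mem_ball ha hz)
  rw [diskAut, div_eq_iff h1, one_sub_conj_mul_diskAut ha hz, Complex.ofReal_sub,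
    norm_sq_eq_mul_conj, diskAut, div_eq_mul_inv]
  push_cast
  linear_combination -a * mul_inv_cancel₀ h

theorem diskAut_image_ball {a : ℂ} (ha : a ∈ ball (0 : ℂ) 1) :
    diskAut a '' ball 0 1 = ball 0 1 := by
  ext z
  constructor
  · rintro ⟨w, hw, rfl⟩
    exact diskAut_mem_ball ha hw
  · exact fun hz => ⟨diskAut a z, diskAut_mem_ball ha hz, diskAut_diskAut ha hz⟩

theorem injOn_diskAut {a : ℂ} (ha : a ∈ ball (0 : ℂ) 1) : InjOn (diskAut a) (ball 0 1) :=
  fun z hz w hw h => by rw [← diskAut_diskAut ha hz, h, diskAut_diskAut ha hw]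

theorem hasDerivAt_diskAut {a z : ℂ} (ha : a ∈ ball (0 : ℂ) 1) (hz : z ∈ ball (0 : ℂ) 1) :
    HasDerivAt (diskAut a) (-((1 - ‖a‖ ^ 2 : ℝ) : ℂ) / (1 - conj a * z) ^ 2) z := by
  have h := one_sub_conj_mul_ne_zero ha hz
  have h1 : HasDerivAt (fun z => a - z) (-1) z := by
    simpa using (hasDerivAt_id z).const_sub a
  have h2 : HasDerivAt (fun z => 1 - conj a * z) (-conj a) z := by
    simpa using ((hasDerivAt_id z).const_mul (conj a)).const_sub 1
  refine (h1.div h2 h).congr_deriv ?_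
  rw [Complex.ofReal_sub, norm_sq_eq_mul_conj]
  push_cast
  ring

theorem analyticOnNhd_diskAut {a : ℂ} (ha : a ∈ ball (0 : ℂ) 1) :
    AnalyticOnNhd ℂ (diskAut a) (ball 0 1) :=
  DifferentiableOn.analyticOnNhd
    (fun _ hz => (hasDerivAt_diskAut ha hz).differentiableAt.differentiableWithinAt) isOpen_ball

theorem abs_det_smulRight_restrictScalars (d : ℂ) :
    |((ContinuousLinearMap.toSpanSingleton ℂ d).restrictScalars ℝ).det| = ‖d‖ ^ 2 := by
  have : ((ContinuousLinearMap.toSpanSingleton ℂ d).restrictScalars ℝ).det = ‖d‖ ^ 2 := by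
    rw [ContinuousLinearMap.det]
    have h := LinearMap.det_restrictScalars (R := ℝ) (S := ℂ) (A := ℂ)
      (f := (ContinuousLinearMap.toSpanSingleton ℂ d : ℂ →L[ℂ] ℂ).toLinearMap)
    rw [LinearMap.det_ring, Algebra.norm_complex_apply, Complex.normSq_eq_norm_sq] at h
    simpa using h
  rw [this, abs_of_nonneg (by positivity)]

theorem lintegral_bergmanMeasure_eq_setLIntegral (α : ℝ) (h : ℂ → ℝ≥0∞) :
    ∫⁻ z, h z ∂bergmanMeasure α = ∫⁻ z in ball (0 : ℂ) 1,
      ENNReal.ofReal (π⁻¹ * ((α + 1) * (1 - ‖z‖ ^ 2) ^ α)) * h z := by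
  rw [lintegral_bergmanMeasure, ← lintegral_indicator measurableSet_ball]
  refine lintegral_congr fun z => ?_
  by_cases hz : z ∈ ball (0 : ℂ) 1
  · have hz1 : ‖z‖ < 1 := by simpa using hz
    rw [indicator_of_mem hz, radialDensity, if_pos hz1]
  · have hz1 : ¬ ‖z‖ < 1 := by simpa using hz
    rw [indicator_of_notMem hz, radialDensity, if_neg hz1, zero_mul]

/-- The change of variables `z = φ_a(w)` for the measure `ω_α dA`. -/
theorem lintegral_bergmanMeasure_diskAut {α : ℝ} (hα : -1 < α) {a : ℂ} (ha : a ∈ ball (0 : ℂ) 1)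
    (h : ℂ → ℝ≥0∞) :
    ∫⁻ z, h z ∂bergmanMeasure α = ∫⁻ w, h (diskAut a w) *
      ENNReal.ofReal (((1 - ‖a‖ ^ 2) / ‖1 - conj a * w‖ ^ 2) ^ (2 + α)) ∂bergmanMeasure α := by
  rw [lintegral_bergmanMeasure_eq_setLIntegral, lintegral_bergmanMeasure_eq_setLIntegral]
  conv_lhs => rw [← diskAut_image_ball ha]
  rw [lintegral_image_eq_lintegral_abs_det_fderiv_mul volume measurableSet_ball
    (fun z hz => ((hasDerivAt_diskAut ha hz).hasFDerivAt.restrictScalars ℝ).hasFDerivWithinAt)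
    (injOn_diskAut ha)]
  refine setLIntegral_congr_fun measurableSet_ball fun w hw => ?_
  have hA := one_sub_norm_sq_pos ha
  have hW := one_sub_norm_sq_pos hw
  have hD : 0 < ‖1 - conj a * w‖ ^ 2 := by
    have := norm_pos_iff.2 (one_sub_conj_mul_ne_zero ha hw)
    positivity
  have hα1 : 0 < α + 1 := by linarith
  rw [abs_det_smulRight_restrictScalars, one_sub_norm_diskAut_sq ha hw, norm_div, norm_neg,
    norm_pow, Complex.norm_real, norm_of_nonneg hA.le]
  rw [mul_comm (h _), ← mul_assoc (ENNReal.ofReal _) (ENNReal.ofReal _),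
    ← mul_assoc (ENNReal.ofReal _) (ENNReal.ofReal _), ← ENNReal.ofReal_mul (by positivity),
    ← ENNReal.ofReal_mul (by positivity)]
  congr 2
  -- In the exponent 2 + α, the 2 comes from the real Jacobian |φ_a'|² and the α from the weight.
  rw [rpow_add (by positivity), rpow_two, mul_div_right_comm,
    mul_rpow (by positivity) hW.le]
  ring

/-! ### The weighted composition isometry and division by φ_a^N -/

/-- The factor `((1 - |a|²) / (1 - conj a * w)²)^{(2 + α) / p}`. -/
noncomputable def autFactor (p α : ℝ) (a w : ℂ) : ℂ :=
  (((1 - ‖a‖ ^ 2) ^ ((2 + α) / p) : ℝ) : ℂ) / (1 - conj a * w) ^ ((2 * (2 + α) / p : ℝ) : ℂ)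

section

variable {p α : ℝ} {a : ℂ}

theorem one_sub_conj_mul_mem_slitPlane {w : ℂ} (ha : a ∈ ball (0 : ℂ) 1)
    (hw : w ∈ ball (0 : ℂ) 1) : 1 - conj a * w ∈ Complex.slitPlane :=
  Or.inl (re_one_sub_conj_mul_pos ha hw)

theorem analyticOnNhd_autFactor (p α : ℝ) (ha : a ∈ ball (0 : ℂ) 1) :
    AnalyticOnNhd ℂ (autFactor p α a) (ball 0 1) := fun w hw => by
  have h1 : AnalyticAt ℂ (fun w => 1 - conj a * w) w := by fun_prop
  refine analyticAt_const.div (h1.cpow analyticAt_const (one_sub_conj_mul_mem_slitPlane ha hw)) ?_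
  rw [Complex.cpow_ne_zero_iff]
  exact Or.inl (one_sub_conj_mul_ne_zero ha hw)

/-- The exponents in `autFactor` are chosen so that g ↦ (g ∘ φ_a) · `autFactor p α a` preserves the
Bergman norm. -/
theorem enorm_autFactor_rpow (hp : 0 < p) (α : ℝ) {w : ℂ} (ha : a ∈ ball (0 : ℂ) 1)
    (hw : w ∈ ball (0 : ℂ) 1) :
    ‖autFactor p α a w‖ₑ ^ p =
      ENNReal.ofReal (((1 - ‖a‖ ^ 2) / ‖1 - conj a * w‖ ^ 2) ^ (2 + α)) := by
  have hA := one_sub_norm_sq_pos ha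
  have hD := one_sub_conj_mul_ne_zero ha hw
  rw [← ofReal_norm, ENNReal.ofReal_rpow_of_nonneg (norm_nonneg _) hp.le, autFactor, norm_div,
    Complex.norm_real, norm_of_nonneg (rpow_nonneg hA.le _), Complex.norm_cpow_of_ne_zero hD,
    Complex.ofReal_im, mul_zero, exp_zero, div_one, Complex.ofReal_re,
    div_rpow (rpow_nonneg hA.le _) (rpow_nonneg (norm_nonneg _) _), ← rpow_mul hA.le,
    ← rpow_mul (norm_nonneg _), div_rpow hA.le (by positivity), div_mul_cancel₀ _ hp.ne',
    div_mul_cancel₀ _ hp.ne', rpow_mul (norm_nonneg _), rpow_two]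

/-- Makes the weighted composition an involution. The principal power splits over (1 - |a|²)(1 -
conj a * w)⁻¹ because the first factor is positive and the second avoids the branch cut. -/
theorem autFactor_diskAut_mul (p α : ℝ) {w : ℂ} (ha : a ∈ ball (0 : ℂ) 1)
    (hw : w ∈ ball (0 : ℂ) 1) : autFactor p α a (diskAut a w) * autFactor p α a w = 1 := by
  have hA := one_sub_norm_sq_pos ha
  have hD := one_sub_conj_mul_ne_zero ha hw
  have harg : (1 - conj a * w).arg ≠ π :=
    Complex.mem_slitPlane_iff_arg.1 (one_sub_conj_mul_mem_slitPlane ha hw) |>.1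
  set q : ℝ := 2 * (2 + α) / p with hq
  have hne : (1 - conj a * w) ^ (q : ℂ) ≠ 0 := by
    rw [Complex.cpow_ne_zero_iff]; exact Or.inl hD
  have hcpow : (((1 - ‖a‖ ^ 2 : ℝ) : ℂ) * (1 - conj a * w)⁻¹) ^ (q : ℂ) =
      (((1 - ‖a‖ ^ 2) ^ q : ℝ) : ℂ) * ((1 - conj a * w) ^ (q : ℂ))⁻¹ := by
    rw [← Complex.inv_cpow _ _ harg, Complex.ofReal_cpow hA.le,
      Complex.cpow_def_of_ne_zero (mul_ne_zero (Complex.ofReal_ne_zero.2 hA.ne') (inv_ne_zero hD)),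
      Complex.cpow_def_of_ne_zero (Complex.ofReal_ne_zero.2 hA.ne'),
      Complex.cpow_def_of_ne_zero (inv_ne_zero hD), ← Complex.exp_add,
      Complex.log_ofReal_mul hA (inv_ne_zero hD), Complex.ofReal_log hA.le, add_mul]
  have hsq : (1 - ‖a‖ ^ 2) ^ q = (1 - ‖a‖ ^ 2) ^ ((2 + α) / p) * (1 - ‖a‖ ^ 2) ^ ((2 + α) / p) := by
    rw [← rpow_add hA, hq]
    congr 1
    ring
  have hc : (((1 - ‖a‖ ^ 2) ^ ((2 + α) / p) : ℝ) : ℂ) ≠ 0 :=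
    Complex.ofReal_ne_zero.2 (rpow_pos_of_pos hA _).ne'
  rw [autFactor, autFactor, ← hq, one_sub_conj_mul_diskAut ha hw, hcpow, hsq, Complex.ofReal_mul]
  generalize (((1 - ‖a‖ ^ 2) ^ ((2 + α) / p) : ℝ) : ℂ) = c at *
  field_simp

theorem extremalFun_eq (p α : ℝ) (N : ℕ) {z : ℂ} (ha : a ∈ ball (0 : ℂ) 1)
    (hz : z ∈ ball (0 : ℂ) 1) :
    extremalFun p α N a z = diskAut a z ^ N * autFactor p α a z := by
  have hD := one_sub_conj_mul_ne_zero ha hz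
  rw [extremalFun, diskAut, autFactor, Complex.ofReal_add, Complex.cpow_add _ _ hD,
    Complex.ofReal_natCast, Complex.cpow_natCast, div_pow, div_mul_div_comm]

theorem diskAut_eq_zero_iff {z : ℂ} (ha : a ∈ ball (0 : ℂ) 1) (hz : z ∈ ball (0 : ℂ) 1) :
    diskAut a z = 0 ↔ z = a := by
  rw [diskAut, div_eq_zero_iff, or_iff_left (one_sub_conj_mul_ne_zero ha hz), sub_eq_zero, eq_comm]

theorem divAut_eq {N : ℕ} {f g : ℂ → ℂ} {z : ℂ} (ha : a ∈ ball (0 : ℂ) 1)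
    (hz : z ∈ ball (0 : ℂ) 1) (hza : z ≠ a) (h : f z = diskAut a z ^ N * g z) :
    divAut a N f z = g z := by
  rw [divAut, h, mul_div_cancel_left₀]
  exact pow_ne_zero _ (mt (diskAut_eq_zero_iff ha hz).1 hza)

/-- An analytic function with a zero of order at least `N` at `a` is divisible by `φ_a ^ N`. -/
theorem exists_eq_diskAut_pow_mul {N : ℕ} {f : ℂ → ℂ} (ha : a ∈ ball (0 : ℂ) 1)
    (hf : AnalyticOnNhd ℂ f (ball 0 1)) (h : ∀ k < N, iteratedDeriv k f a = 0) :
    ∃ g, AnalyticOnNhd ℂ g (ball 0 1) ∧ ∀ z ∈ ball (0 : ℂ) 1, f z = diskAut a z ^ N * g z := by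
  classical
  obtain ⟨q, hq, hfq⟩ := (natCast_le_analyticOrderAt (hf a ha)).1
    ((natCast_le_analyticOrderAt_iff_iteratedDeriv_eq_zero (hf a ha)).2 h)
  -- With f = (z - a)^N q near a, this is f/φ_a^N; its value at a fills the removable singularity.
  set g₀ : ℂ → ℂ := fun z => (-1) ^ N * q z * (1 - conj a * z) ^ N with hg₀
  have hg₀a : AnalyticAt ℂ g₀ a := by fun_prop
  have hfac : ∀ᶠ z in 𝓝 a, f z = diskAut a z ^ N * g₀ z := by
    filter_upwards [hfq, isOpen_ball.eventually_mem ha] with z hz hzb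
    have hD := pow_ne_zero N (one_sub_conj_mul_ne_zero ha hzb)
    rw [hz, hg₀, diskAut, div_pow, smul_eq_mul, ← neg_sub a z, neg_pow, div_mul_eq_mul_div,
      eq_div_iff hD]
    ring
  set g : ℂ → ℂ := Function.update (fun z => f z / diskAut a z ^ N) a (g₀ a) with hg
  have hgev : g₀ =ᶠ[𝓝 a] g := by
    filter_upwards [hfac, isOpen_ball.eventually_mem ha] with z hz hzb
    rcases eq_or_ne z a with rfl | hza
    · rw [hg, Function.update_self]
    · rw [hg, Function.update_of_ne hza, hz, mul_div_cancel_left₀]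
      exact pow_ne_zero _ (mt (diskAut_eq_zero_iff ha hzb).1 hza)
  refine ⟨g, fun z hz => ?_, fun z hz => ?_⟩
  · rcases eq_or_ne z a with rfl | hza
    · exact hg₀a.congr hgev
    · have hd := pow_ne_zero N (mt (diskAut_eq_zero_iff ha hz).1 hza)
      refine ((hf z hz).fun_div ((analyticOnNhd_diskAut ha z hz).fun_pow N) hd).congr ?_
      filter_upwards [isOpen_ne.eventually_mem hza] with w hw
      rw [hg, Function.update_of_ne hw]
  · rcases eq_or_ne z a with rfl | hza
    · rw [hg, Function.update_self]
      exact hfac.self_of_nhds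
    · rw [hg, Function.update_of_ne hza, mul_div_cancel₀]
      exact pow_ne_zero N (mt (diskAut_eq_zero_iff ha hz).1 hza)

theorem iteratedDeriv_eq_zero_of_eq_diskAut_pow_mul {N : ℕ} {f g : ℂ → ℂ}
    (ha : a ∈ ball (0 : ℂ) 1) (hf : AnalyticOnNhd ℂ f (ball 0 1))
    (hg : AnalyticOnNhd ℂ g (ball 0 1))
    (h : ∀ z ∈ ball (0 : ℂ) 1, f z = diskAut a z ^ N * g z) :
    ∀ k < N, iteratedDeriv k f a = 0 := by
  rw [← natCast_le_analyticOrderAt_iff_iteratedDeriv_eq_zero (hf a ha),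
    natCast_le_analyticOrderAt (hf a ha)]
  have hD := pow_ne_zero N (one_sub_conj_mul_ne_zero ha ha)
  have hga := hg a ha
  refine ⟨fun z => (-1) ^ N * g z / (1 - conj a * z) ^ N,
    AnalyticAt.fun_div (by fun_prop) (by fun_prop) hD, ?_⟩
  filter_upwards [isOpen_ball.eventually_mem ha] with z hz
  rw [h z hz, diskAut, div_pow, smul_eq_mul, ← neg_sub z a, neg_pow]
  ring

theorem lintegral_eq_lintegral_comp_diskAut_mul (hp : 0 < p) (hα : -1 < α)
    (ha : a ∈ ball (0 : ℂ) 1) (g : ℂ → ℂ) :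
    ∫⁻ z, ‖g z‖ₑ ^ p ∂bergmanMeasure α =
      ∫⁻ w, ‖g (diskAut a w) * autFactor p α a w‖ₑ ^ p ∂bergmanMeasure α := by
  rw [lintegral_bergmanMeasure_diskAut hα ha]
  refine lintegral_congr_ae ?_
  filter_upwards [ae_bergmanMeasure_mem_ball α] with w hw
  rw [enorm_mul, ENNReal.mul_rpow_of_nonneg _ _ hp.le, enorm_autFactor_rpow hp α ha hw]

/-- Under z = φ_a(w) the factor φ_a(z)^N becomes w^N, since φ_a is an involution. -/
theorem lintegral_diskAut_pow_mul (hp : 0 < p) (hα : -1 < α) (ha : a ∈ ball (0 : ℂ) 1) (N : ℕ)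
    {f g : ℂ → ℂ} (h : ∀ z ∈ ball (0 : ℂ) 1, f z = diskAut a z ^ N * g z) :
    ∫⁻ z, ‖f z‖ₑ ^ p ∂bergmanMeasure α = ∫⁻ w, ENNReal.ofReal (‖w‖ ^ (N * p)) *
      ‖g (diskAut a w) * autFactor p α a w‖ₑ ^ p ∂bergmanMeasure α := by
  rw [lintegral_eq_lintegral_comp_diskAut_mul hp hα ha]
  refine lintegral_congr_ae ?_
  filter_upwards [ae_bergmanMeasure_mem_ball α] with w hw
  rw [h _ (diskAut_mem_ball ha hw), diskAut_diskAut ha hw, mul_assoc, enorm_mul,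
    ENNReal.mul_rpow_of_nonneg _ _ hp.le, ← ofReal_norm (w ^ N),
    ENNReal.ofReal_rpow_of_nonneg (norm_nonneg _) hp.le, norm_pow, rpow_mul (norm_nonneg _),
    rpow_natCast]

theorem lintegral_divAut (α : ℝ) (ha : a ∈ ball (0 : ℂ) 1) (N : ℕ)
    {f g : ℂ → ℂ} (h : ∀ z ∈ ball (0 : ℂ) 1, f z = diskAut a z ^ N * g z) :
    ∫⁻ z, ‖divAut a N f z‖ₑ ^ p ∂bergmanMeasure α = ∫⁻ z, ‖g z‖ₑ ^ p ∂bergmanMeasure α := by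
  refine lintegral_congr_ae ?_
  have hne : ∀ᵐ z ∂bergmanMeasure α, z ≠ a :=
    (bergmanMeasure_absolutelyContinuous α).ae_le (Measure.ae_ne volume a)
  filter_upwards [ae_bergmanMeasure_mem_ball α, hne] with z hz hza
  rw [divAut_eq ha hz hza (h z hz)]

theorem bergmanNorm_lt_top_iff (hp : 0 < p) (α : ℝ) (f : ℂ → ℂ) :
    bergmanNorm p α f < ∞ ↔ ∫⁻ z, ‖f z‖ₑ ^ p ∂bergmanMeasure α < ∞ := by
  rw [bergmanNorm_eq, ENNReal.rpow_lt_top_iff_of_pos (by positivity)]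

end

/-! ### The norm inequality, the equality case and sharpness -/

section

variable {p α : ℝ} {a : ℂ} {N : ℕ}

theorem ofReal_rpow_mul_rpow (hp : 0 < p) (hα : -1 < α) (X : ℝ≥0∞) :
    ENNReal.ofReal ((Gamma (N * p / 2 + 2 + α) /
        (Gamma (2 + α) * Gamma (N * p / 2 + 1))) ^ (1 / p)) * X ^ (1 / p) =
      ((ENNReal.ofReal (bergmanMoment α (N * p)))⁻¹ * X) ^ (1 / p) := by
  have hs : 0 ≤ N * p := by positivity
  have hm := bergmanMoment_pos hα hs
  have h1 : Gamma (N * p / 2 + 2 + α) / (Gamma (2 + α) * Gamma (N * p / 2 + 1)) =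
      (bergmanMoment α (N * p))⁻¹ := by
    rw [bergmanMoment, inv_div, mul_comm (Gamma (2 + α))]
  rw [h1, ← ENNReal.ofReal_rpow_of_nonneg (inv_nonneg.2 hm.le) (by positivity),
    ENNReal.ofReal_inv_of_pos hm, ENNReal.mul_rpow_of_nonneg _ _ (by positivity)]

theorem le_inv_ofReal_mul_iff {m : ℝ} (hm : 0 < m) {X Y : ℝ≥0∞} :
    X ≤ (ENNReal.ofReal m)⁻¹ * Y ↔ ENNReal.ofReal m * X ≤ Y := by
  rw [mul_comm _ Y, ← div_eq_mul_inv,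
    ENNReal.le_div_iff_mul_le (Or.inl (by simpa using hm)) (Or.inl ENNReal.ofReal_ne_top), mul_comm]

theorem eq_inv_ofReal_mul_iff {m : ℝ} (hm : 0 < m) {X Y : ℝ≥0∞} :
    X = (ENNReal.ofReal m)⁻¹ * Y ↔ ENNReal.ofReal m * X = Y := by
  have h0 : ENNReal.ofReal m ≠ 0 := by simpa using hm
  constructor
  · rintro rfl
    rw [← mul_assoc, ENNReal.mul_inv_cancel h0 ENNReal.ofReal_ne_top, one_mul]
  · rintro rfl
    rw [← mul_assoc, ENNReal.inv_mul_cancel h0 ENNReal.ofReal_ne_top, one_mul]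

theorem analyticOnNhd_comp_diskAut_mul (p α : ℝ) (ha : a ∈ ball (0 : ℂ) 1) {g : ℂ → ℂ}
    (hg : AnalyticOnNhd ℂ g (ball 0 1)) :
    AnalyticOnNhd ℂ (fun w => g (diskAut a w) * autFactor p α a w) (ball 0 1) := fun w hw =>
  AnalyticAt.fun_mul (AnalyticAt.fun_comp (hg _ (diskAut_mem_ball ha hw))
    (analyticOnNhd_diskAut ha w hw)) (analyticOnNhd_autFactor p α ha w hw)

theorem natCast_mul_pos (hp : 0 < p) (hN : 1 ≤ N) : 0 < N * p :=
  mul_pos (by exact_mod_cast hN) hp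

theorem bergmanNorm_divAut_le (hp : 0 < p) (hα : -1 < α) (hN : 1 ≤ N) (ha : a ∈ ball (0 : ℂ) 1)
    {f g : ℂ → ℂ} (hg : AnalyticOnNhd ℂ g (ball 0 1))
    (h : ∀ z ∈ ball (0 : ℂ) 1, f z = diskAut a z ^ N * g z) :
    bergmanNorm p α (divAut a N f) ≤ ENNReal.ofReal ((Gamma (N * p / 2 + 2 + α) /
      (Gamma (2 + α) * Gamma (N * p / 2 + 1))) ^ (1 / p)) * bergmanNorm p α f := by
  have hs := natCast_mul_pos hp hN
  rw [bergmanNorm_eq, bergmanNorm_eq, ofReal_rpow_mul_rpow hp hα, lintegral_divAut α ha N h,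
    lintegral_diskAut_pow_mul hp hα ha N h, lintegral_eq_lintegral_comp_diskAut_mul hp hα ha]
  refine ENNReal.rpow_le_rpow ?_ (by positivity)
  rw [le_inv_ofReal_mul_iff (bergmanMoment_pos hα hs.le)]
  exact bergmanMoment_mul_lintegral_le hp hα hs (analyticOnNhd_comp_diskAut_mul p α ha hg)

/-- Equality means that G = (g ∘ φ_a) · `autFactor p α a` is constant; substituting φ_a(z) turns
this into g = c · `autFactor p α a`. Finiteness excludes the vacuous equality ∞ = ∞. -/
theorem bergmanNorm_divAut_eq_iff (hp : 0 < p) (hα : -1 < α) (hN : 1 ≤ N)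
    (ha : a ∈ ball (0 : ℂ) 1) {f g : ℂ → ℂ} (hg : AnalyticOnNhd ℂ g (ball 0 1))
    (h : ∀ z ∈ ball (0 : ℂ) 1, f z = diskAut a z ^ N * g z)
    (hfin : bergmanNorm p α (divAut a N f) < ∞) :
    bergmanNorm p α (divAut a N f) = ENNReal.ofReal ((Gamma (N * p / 2 + 2 + α) /
        (Gamma (2 + α) * Gamma (N * p / 2 + 1))) ^ (1 / p)) * bergmanNorm p α f ↔
      ∃ c : ℂ, ∀ z ∈ ball (0 : ℂ) 1, g z = c * autFactor p α a z := by
  have hs := natCast_mul_pos hp hN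
  have hG := analyticOnNhd_comp_diskAut_mul p α ha hg
  rw [bergmanNorm_lt_top_iff hp, lintegral_divAut α ha N h,
    lintegral_eq_lintegral_comp_diskAut_mul hp hα ha] at hfin
  rw [bergmanNorm_eq, bergmanNorm_eq, ofReal_rpow_mul_rpow hp hα, lintegral_divAut α ha N h,
    lintegral_diskAut_pow_mul hp hα ha N h, lintegral_eq_lintegral_comp_diskAut_mul hp hα ha,
    (ENNReal.rpow_left_injective (one_div_pos.2 hp).ne').eq_iff,
    eq_inv_ofReal_mul_iff (bergmanMoment_pos hα hs.le)]
  constructor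
  · intro heq
    have hc := eq_const_of_bergmanMoment_mul_lintegral_eq hp hα hs hG hfin.ne heq
    refine ⟨g (diskAut a 0) * autFactor p α a 0, fun z hz => ?_⟩
    rw [← hc _ (diskAut_mem_ball ha hz), diskAut_diskAut ha hz, mul_assoc,
      autFactor_diskAut_mul p α ha hz, mul_one]
  · rintro ⟨c, hc⟩
    have hGc : ∀ᵐ w ∂bergmanMeasure α, g (diskAut a w) * autFactor p α a w = c := by
      filter_upwards [ae_bergmanMeasure_mem_ball α] with w hw
      rw [hc _ (diskAut_mem_ball ha hw), mul_assoc, autFactor_diskAut_mul p α ha hw, mul_one]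
    have h1 : ∫⁻ w, ‖g (diskAut a w) * autFactor p α a w‖ₑ ^ p ∂bergmanMeasure α =
        ∫⁻ _, ‖c‖ₑ ^ p * 1 ∂bergmanMeasure α :=
      lintegral_congr_ae (hGc.mono fun w hw => by simp only [hw, mul_one])
    have h2 : ∫⁻ w, ENNReal.ofReal (‖w‖ ^ (N * p)) *
          ‖g (diskAut a w) * autFactor p α a w‖ₑ ^ p ∂bergmanMeasure α =
        ∫⁻ w, ENNReal.ofReal (‖w‖ ^ (N * p)) * ‖c‖ₑ ^ p ∂bergmanMeasure α :=
      lintegral_congr_ae (hGc.mono fun w hw => by simp only [hw])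
    rw [h1, h2, lintegral_const_mul _ measurable_const, lintegral_mul_const _ (by fun_prop),
      lintegral_one_bergmanMeasure hα, mul_one, lintegral_norm_rpow hα hs.le]

/-- For this function the transformed quotient G is 1, so the p-th power of its norm is the moment
of order Np. -/
theorem extremalFun_mem_bergmanVanishing (hp : 0 < p) (hα : -1 < α) (N : ℕ)
    (ha : a ∈ ball (0 : ℂ) 1) : extremalFun p α N a ∈ bergmanVanishing p α N a := by
  have hJ := analyticOnNhd_autFactor p α ha
  have heq := fun z hz => extremalFun_eq p α N (z := z) ha hz
  have hana : AnalyticOnNhd ℂ (extremalFun p α N a) (ball 0 1) :=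
    (AnalyticOnNhd.mul ((analyticOnNhd_diskAut ha).pow N) hJ).congr isOpen_ball
      fun z hz => (heq z hz).symm
  refine ⟨⟨hana, ?_⟩, iteratedDeriv_eq_zero_of_eq_diskAut_pow_mul ha hana hJ heq⟩
  rw [bergmanNorm_lt_top_iff hp, lintegral_diskAut_pow_mul hp hα ha N heq,
    lintegral_congr_ae (g := fun w => ENNReal.ofReal (‖w‖ ^ (N * p))),
    lintegral_norm_rpow hα (by positivity)]
  · exact ENNReal.ofReal_lt_top
  · filter_upwards [ae_bergmanMeasure_mem_ball α] with w hw
    rw [autFactor_diskAut_mul p α ha hw, enorm_one, ENNReal.one_rpow, mul_one]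

theorem bergmanNorm_extremalFun_ne_zero (hp : 0 < p) (hα : -1 < α) (N : ℕ)
    (ha : a ∈ ball (0 : ℂ) 1) : bergmanNorm p α (extremalFun p α N a) ≠ 0 := by
  have hs : 0 ≤ N * p := by positivity
  rw [bergmanNorm_eq, lintegral_diskAut_pow_mul hp hα ha N fun z hz => extremalFun_eq p α N ha hz,
    lintegral_congr_ae (g := fun w => ENNReal.ofReal (‖w‖ ^ (N * p))), lintegral_norm_rpow hα hs]
  · have := bergmanMoment_pos hα hs
    refine (ENNReal.rpow_pos ?_ ENNReal.ofReal_ne_top).ne'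
    simpa using this
  · filter_upwards [ae_bergmanMeasure_mem_ball α] with w hw
    rw [autFactor_diskAut_mul p α ha hw, enorm_one, ENNReal.one_rpow, mul_one]

theorem bergmanVanishing_divAut (hp : 0 < p) (hα : -1 < α) (hN : 1 ≤ N)
    (ha : a ∈ ball (0 : ℂ) 1) {K : ℝ≥0∞} (hK : K = ENNReal.ofReal
      ((Gamma (N * p / 2 + 2 + α) / (Gamma (2 + α) * Gamma (N * p / 2 + 1))) ^ (1 / p))) :
    (∀ f ∈ bergmanVanishing p α N a,
      (∃ g ∈ bergmanSpace p α, ∀ z ∈ unitDisk, z ≠ a → g z = divAut a N f z) ∧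
      bergmanNorm p α (divAut a N f) ≤ K * bergmanNorm p α f) ∧
    (∀ f ∈ bergmanVanishing p α N a,
      bergmanNorm p α (divAut a N f) = K * bergmanNorm p α f ↔
        ∃ c : ℂ, ∀ z ∈ unitDisk, f z = c * extremalFun p α N a z) := by
  have hKtop : K ≠ ∞ := by rw [hK]; exact ENNReal.ofReal_ne_top
  refine ⟨fun f hf => ?_, fun f hf => ?_⟩ <;>
    obtain ⟨⟨hfa, hfn⟩, hfz⟩ := hf <;>
    obtain ⟨g, hg, hfg⟩ := exists_eq_diskAut_pow_mul ha hfa hfz <;>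
    have hle := bergmanNorm_divAut_le hp hα hN ha hg hfg <;>
    rw [← hK] at hle <;>
    have hfin := hle.trans_lt (ENNReal.mul_lt_top hKtop.lt_top hfn)
  · refine ⟨⟨g, ⟨hg, ?_⟩, fun z hz hza => (divAut_eq ha hz hza (hfg z hz)).symm⟩, hle⟩
    rwa [bergmanNorm_eq, ← lintegral_divAut α ha N hfg, ← bergmanNorm_eq]
  · rw [hK, bergmanNorm_divAut_eq_iff hp hα hN ha hg hfg hfin]
    constructor
    · rintro ⟨c, hc⟩
      refine ⟨c, fun z hz => ?_⟩
      rw [hfg z hz, hc z hz, extremalFun_eq p α N ha hz]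
      ring
    · rintro ⟨c, hc⟩
      have hJ := analyticOnNhd_autFactor p α ha
      -- φ_a^N can be cancelled only away from a; the identity theorem then covers the whole disk.
      have hfreq : ∀ᶠ z in 𝓝[≠] a, g z = c * autFactor p α a z := by
        filter_upwards [mem_nhdsWithin_of_mem_nhds (isOpen_ball.mem_nhds ha),
          self_mem_nhdsWithin] with z hz hza
        have hd := pow_ne_zero N (mt (diskAut_eq_zero_iff ha hz).1 hza)
        refine mul_left_cancel₀ hd ?_
        rw [← hfg z hz, hc z hz, extremalFun_eq p α N ha hz]
        ring
      exact ⟨c, hg.eqOn_of_preconnected_of_frequently_eq (analyticOnNhd_const.mul hJ)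
        (convex_ball (0 : ℂ) 1).isPreconnected ha hfreq.frequently⟩

/-- The extremal function attains equality, and its finite nonzero norm can be cancelled from K ‖f‖
≤ C ‖f‖. -/
theorem isLeast_bergmanVanishing (hp : 0 < p) (hα : -1 < α) (hN : 1 ≤ N)
    (ha : a ∈ ball (0 : ℂ) 1) {K : ℝ≥0∞} (hK : K = ENNReal.ofReal
      ((Gamma (N * p / 2 + 2 + α) / (Gamma (2 + α) * Gamma (N * p / 2 + 1))) ^ (1 / p))) :
    IsLeast {C : ℝ≥0∞ | ∀ f ∈ bergmanVanishing p α N a,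
      bergmanNorm p α (divAut a N f) ≤ C * bergmanNorm p α f} K := by
  obtain ⟨hle, heq⟩ := bergmanVanishing_divAut hp hα hN ha hK
  refine ⟨fun f hf => (hle f hf).2, fun C hC => ?_⟩
  have hext := extremalFun_mem_bergmanVanishing hp hα N ha
  have h1 := hC _ hext
  rw [(heq _ hext).2 ⟨1, fun z _ => (one_mul _).symm⟩] at h1
  exact (ENNReal.mul_le_mul_iff_left (bergmanNorm_extremalFun_ne_zero hp hα N ha)
    hext.1.2.ne).1 h1

end

end

/-! ### The theorem and its unweighted case -/

theorem mainTheorem1 (p : ℝ) (hp : 0 < p) :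
    (∀ α : ℝ, -1 < α → ∀ N : ℕ, 1 ≤ N → ∀ a ∈ unitDisk, ∀ K : ℝ≥0∞,
      K = ENNReal.ofReal
        ((Real.Gamma (N * p / 2 + 2 + α) /
          (Real.Gamma (2 + α) * Real.Gamma (N * p / 2 + 1))) ^ (1 / p)) →
      -- the quotient (with its removable singularity removed) lies in the space,
      -- and the norm inequality holds
      (∀ f ∈ bergmanVanishing p α N a,
        (∃ g ∈ bergmanSpace p α, ∀ z ∈ unitDisk, z ≠ a → g z = divAut a N f z) ∧
        bergmanNorm p α (divAut a N f) ≤ K * bergmanNorm p α f) ∧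
      -- the inequality is sharp: no smaller constant works
      IsLeast {C : ℝ≥0∞ | ∀ f ∈ bergmanVanishing p α N a,
        bergmanNorm p α (divAut a N f) ≤ C * bergmanNorm p α f} K ∧
      -- equality holds exactly for the constant multiples of the extremal function
      extremalFun p α N a ∈ bergmanVanishing p α N a ∧
      (∀ f ∈ bergmanVanishing p α N a,
        bergmanNorm p α (divAut a N f) = K * bergmanNorm p α f ↔
          ∃ c : ℂ, ∀ z ∈ unitDisk, f z = c * extremalFun p α N a z)) ∧
    -- the unweighted case with a simple zero
    (∀ a ∈ unitDisk,
      IsLeast {C : ℝ≥0∞ | ∀ f ∈ bergmanSpace p 0, f a = 0 →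
        bergmanNorm p 0 (fun z => f z / diskAut a z) ≤ C * bergmanNorm p 0 f}
        (ENNReal.ofReal (((p + 2) / 2) ^ (1 / p)))) := by
  refine ⟨fun α hα N hN a ha K hK => ?_, fun a ha => ?_⟩
  · obtain ⟨hle, heq⟩ := bergmanVanishing_divAut hp hα hN ha hK
    exact ⟨hle, isLeast_bergmanVanishing hp hα hN ha hK,
      extremalFun_mem_bergmanVanishing hp hα N ha, heq⟩
  -- For N = 1, α = 0 the Gamma quotient collapses by Γ(p/2 + 2) = (p/2 + 1) Γ(p/2 + 1).
  · have hK : ENNReal.ofReal (((p + 2) / 2) ^ (1 / p)) = ENNReal.ofReal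
        ((Real.Gamma ((1 : ℕ) * p / 2 + 2 + 0) /
          (Real.Gamma (2 + 0) * Real.Gamma ((1 : ℕ) * p / 2 + 1))) ^ (1 / p)) := by
      have hG : Real.Gamma (p / 2 + 1) ≠ 0 := (Real.Gamma_pos_of_pos (by positivity)).ne'
      rw [Nat.cast_one, one_mul, add_zero, add_zero, Real.Gamma_two, one_mul,
        show p / 2 + 2 = (p / 2 + 1) + 1 by ring, Real.Gamma_add_one (by positivity),
        mul_div_cancel_right₀ _ hG]
      congr 2
      ring
    have h := isLeast_bergmanVanishing hp (by norm_num : (-1 : ℝ) < 0) le_rfl ha hK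
    convert h using 2
    ext C
    simp only [bergmanVanishing, Set.mem_ofPred_eq, Nat.lt_one_iff, forall_eq, iteratedDeriv_zero,
      and_imp]
    refine forall₃_congr fun f _ _ => ?_
    have hd : divAut a 1 f = fun z => f z / diskAut a z := funext fun z => by rw [divAut, pow_one]
    rw [hd]
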